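/- Let $M$ be an $n$-dimensional smooth (Hausdorff) manifold without boundary and let $F:TM\to[0,\infty)$ be a Finsler metric on $M$: $F$ is $C^\infty$ on $TM\setminus\{0\}$, $F(x,y)=0$ iff $y=0$, $F(x,\lambda y)=\lambda F(x,y)$ for $\lambda>0$, and the matrix $g_{ij}(x,y)=\tfrac12[F^2]_{y^iy^j}$ is positive definite for all $y\neq0$. Let $m$ be a smooth measure on $M$, i.e. in every chart $dm=\sigma(x)\,dx^1\cdots dx^n$ with $\sigma$ smooth and positive. Put $G^i=\tfrac14 g^{il}\{[F^2]_{x^my^l}y^m-[F^2]_{x^l}\}$, let $$R^i{}_k=2\frac{\partial G^i}{\partial x^k}-y^j\frac{\partial^2G^i}{\partial x^j\partial y^k}+2G^j\frac{\partial^2G^i}{\partial y^j\partial y^k}-\frac{\partial G^i}{\partial y^j}\frac{\partial G^j}{\partial y^k},\qquad \mathrm{Ric}(x,y)=R^i{}_i(x,y).$$ Geodesics are the smooth curves with $\ddot\gamma^i+2G^i(\gamma,\dot\gamma)=0$ in local coordinates. For $y\ne0$ let $\tau(x,y)=\log\big(\sqrt{\det g_{ij}(x,y)}/\sigma(x)\big)$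 be the distortion, and let $\eta$ be the geodesic with $\eta(0)=x$, $\dot\eta(0)=y$. Let $S(x,y)=\frac{d}{dt}\big|_{t=0}\tau(\eta(t),\dot\eta(t))$ be the S-curvature, and put $\dot S(x,y)=\frac{d}{dt}\big|_{t=0}S(\eta(t),\dot\eta(t))$ and $$\mathrm{Ric}_\infty(x,y)=\mathrm{Ric}(x,y)+\dot S(x,y).$$ For a function $\kappa:M\to\mathbb R$, "$\mathrm{Ric}_\infty=\kappa$ with respect to $m$" means $\mathrm{Ric}_\infty(x,y)=\kappa(x)F(x,y)^2$ for all $x\in M$ and $y\in T_xM\setminus\{0\}$. A geodesic extension of $y\in T_xM\setminus\{0\}$ is a nowhere vanishing $C^\infty$ vector field $Y$ on an open neighbourhood $U$ of $x$ with $Y_x=y$, all of whose integral curves are geodesics of $F$. It induces the Riemannian metric $g_Y=(g_{ij}(\cdot,Y))$ on $U$ and the weight function $\psi$ on $U$ given by $dm=e^{-\psi}dV_{g_Y}$, that is, $\psi(p)=\tau(p,Y_p)$. The triple $(M,F,m)$ is called a gradient almost Ricci soliton with soliton scalar $\kappa$ if for every $x\in M$ and $y\in T_xM\setminus\{0\}$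 there are a geodesic extension $Y$ of $y$, with weight function $\psi$, and a $C^2$ vector field $V$ on $M$ which coincides with $\mathrm{grad}_{g_Y}\psi$ on a neighbourhood of $x$, such that $$2\,\mathrm{Ric}+\mathcal L_{\hat V}(F^2)=2\kappa F^2\quad\text{at }(x,y),$$ where $\hat V=V^i\frac{\partial}{\partial x^i}+y^j\frac{\partial V^i}{\partial x^j}\frac{\partial}{\partial y^i}$ is the complete lift of $V$ to $TM$ and $\mathcal L_{\hat V}(F^2)=\hat V(F^2)$. If $\kappa$ is a constant, $(M,F,m)$ is called a gradient Ricci soliton with soliton constant $\kappa$. **Theorem.** For every function $\kappa:M\to\mathbb R$, $(M,F,m)$ is a gradient almost Ricci soliton with soliton scalar $\kappa$ if and only if $\mathrm{Ric}_\infty=\kappa$ with respect to $m$. In particular, for every constant $\kappa\in\mathbb R$, $(M,F,m)$ is a gradient Ricci soliton with soliton constant $\kappa$ if and only if $\mathrm{Ric}_\infty=\kappa$ with respect to $m$. -/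

import Mathlib

open Set Filter Topology MeasureTheory
open scoped Manifold ContDiff

noncomputable section

namespace FinslerGeom

variable {n : ℕ} {M : Type*} [TopologicalSpace M] [ChartedSpace (EuclideanSpace ℝ (Fin n)) M]

/-! ### Local coordinates on the tangent bundle -/

/-- The local coordinates `(x¹, …, xⁿ; y¹, …, yⁿ)` of a tangent vector in the chart `φ`:
if `p = (x, y)` then `y = ∑ yⁱ ∂/∂xⁱ`. -/
def coords (φ : OpenPartialHomeomorph M (EuclideanSpace ℝ (Fin n)))
    (p : TangentBundle (𝓡 n) M) : EuclideanSpace ℝ (Fin n) × EuclideanSpace ℝ (Fin n) :=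
  (φ p.1, mfderiv (𝓡 n) (𝓡 n) φ p.1 p.2)

/-- The tangent vector whose local coordinates in the chart `φ` are `q = (u, v)`. -/
def ofCoords (φ : OpenPartialHomeomorph M (EuclideanSpace ℝ (Fin n)))
    (q : EuclideanSpace ℝ (Fin n) × EuclideanSpace ℝ (Fin n)) : TangentBundle (𝓡 n) M :=
  ⟨φ.symm q.1, mfderiv (𝓡 n) (𝓡 n) φ.symm q.1 q.2⟩

/-- The partial derivative `∂f/∂xⁱ` of a function `f(x, y)` of the local coordinates. -/
def dx (i : Fin n) (f : EuclideanSpace ℝ (Fin n) × EuclideanSpace ℝ (Fin n) → ℝ)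
    (q : EuclideanSpace ℝ (Fin n) × EuclideanSpace ℝ (Fin n)) : ℝ :=
  fderiv ℝ f q (EuclideanSpace.single i 1, 0)

/-- The partial derivative `∂f/∂yⁱ` of a function `f(x, y)` of the local coordinates. -/
def dy (i : Fin n) (f : EuclideanSpace ℝ (Fin n) × EuclideanSpace ℝ (Fin n) → ℝ)
    (q : EuclideanSpace ℝ (Fin n) × EuclideanSpace ℝ (Fin n)) : ℝ :=
  fderiv ℝ f q (0, EuclideanSpace.single i 1)

/-- The function `F²` in the local coordinates of the chart `φ`. -/
def sqLoc (F : TangentBundle (𝓡 n) M → ℝ)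
    (φ : OpenPartialHomeomorph M (EuclideanSpace ℝ (Fin n)))
    (q : EuclideanSpace ℝ (Fin n) × EuclideanSpace ℝ (Fin n)) : ℝ :=
  F (ofCoords φ q) ^ 2

/-- The matrix `g_ij = ½ ∂²(F²)/∂yⁱ∂yʲ` in the local coordinates of the chart `φ`. -/
def gMatrix (F : TangentBundle (𝓡 n) M → ℝ)
    (φ : OpenPartialHomeomorph M (EuclideanSpace ℝ (Fin n)))
    (q : EuclideanSpace ℝ (Fin n) × EuclideanSpace ℝ (Fin n)) : Matrix (Fin n) (Fin n) ℝ :=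
  Matrix.of fun i j => (1 / 2 : ℝ) * dy i (dy j (sqLoc F φ)) q

/-! ### Finsler metrics, geodesics, Ricci curvature -/

/-- Finsler metrics on `M`. -/
structure IsFinslerMetric [IsManifold (𝓡 n) ∞ M] (F : TangentBundle (𝓡 n) M → ℝ) : Prop where
  nonneg : ∀ p, 0 ≤ F p
  smoothOn : ContMDiffOn (𝓡 n).tangent 𝓘(ℝ, ℝ) ∞ F {p | p.2 ≠ 0}
  eq_zero_iff : ∀ p, F p = 0 ↔ p.2 = 0
  homogeneous : ∀ (x : M) (y : TangentSpace (𝓡 n) x) (c : ℝ), 0 < c →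
    F ⟨x, c • y⟩ = c * F ⟨x, y⟩
  posDef : ∀ φ ∈ atlas (EuclideanSpace ℝ (Fin n)) M, ∀ p : TangentBundle (𝓡 n) M,
    p.1 ∈ φ.source → p.2 ≠ 0 → (gMatrix F φ (coords φ p)).PosDef

/-- The geodesic coefficients `Gⁱ = ¼ gⁱˡ ([F²]_{xᵐyˡ} yᵐ - [F²]_{xˡ})` in the chart `φ`. -/
def spray (F : TangentBundle (𝓡 n) M → ℝ)
    (φ : OpenPartialHomeomorph M (EuclideanSpace ℝ (Fin n))) (i : Fin n)
    (q : EuclideanSpace ℝ (Fin n) × EuclideanSpace ℝ (Fin n)) : ℝ :=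
  (1 / 4 : ℝ) * ∑ l, (gMatrix F φ q)⁻¹ i l *
    ((∑ m, dx m (dy l (sqLoc F φ)) q * q.2 m) - dx l (sqLoc F φ) q)

/-- The Riemann curvature `Rⁱ_k` in the chart `φ`. -/
def riemannLoc (F : TangentBundle (𝓡 n) M → ℝ)
    (φ : OpenPartialHomeomorph M (EuclideanSpace ℝ (Fin n))) (i k : Fin n)
    (q : EuclideanSpace ℝ (Fin n) × EuclideanSpace ℝ (Fin n)) : ℝ :=
  2 * dx k (spray F φ i) q
    - (∑ j, dx j (dy k (spray F φ i)) q * q.2 j)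
    + 2 * (∑ j, spray F φ j q * dy j (dy k (spray F φ i)) q)
    - ∑ j, dy j (spray F φ i) q * dy k (spray F φ j) q

/-- The Ricci curvature `Ric(x, y) = Rⁱ_i(x, y)`, computed in the chart around `x`. -/
def ricci (F : TangentBundle (𝓡 n) M → ℝ) (p : TangentBundle (𝓡 n) M) : ℝ :=
  ∑ i, riemannLoc F (chartAt (EuclideanSpace ℝ (Fin n)) p.1) i i
    (coords (chartAt (EuclideanSpace ℝ (Fin n)) p.1) p)

/-- The canonical lift `t ↦ (γ(t), γ'(t))` of a curve to the tangent bundle. -/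
def curveLift (γ : ℝ → M) (t : ℝ) : TangentBundle (𝓡 n) M :=
  ⟨γ t, mfderiv 𝓘(ℝ, ℝ) (𝓡 n) γ t (1 : ℝ)⟩

/-- `γ` is a geodesic of `F` on the open interval `J`: it is smooth there and satisfies
`γ''ⁱ + 2 Gⁱ(γ, γ') = 0` in all local coordinates. -/
def IsGeodesicOn (F : TangentBundle (𝓡 n) M → ℝ) (γ : ℝ → M) (J : Set ℝ) : Prop :=
  ContMDiffOn 𝓘(ℝ, ℝ) (𝓡 n) ∞ γ J ∧
  ∀ t ∈ J, ∀ φ ∈ atlas (EuclideanSpace ℝ (Fin n)) M, γ t ∈ φ.source → ∀ i,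
    (deriv (deriv (fun s => φ (γ s))) t) i
      + 2 * spray F φ i (φ (γ t), deriv (fun s => φ (γ s)) t) = 0

/-- `η` is a geodesic `(-ε, ε) → M` with `(η(0), η'(0)) = p`. -/
def IsGeodesicThrough (F : TangentBundle (𝓡 n) M → ℝ) (p : TangentBundle (𝓡 n) M)
    (η : ℝ → M) : Prop :=
  ∃ ε : ℝ, 0 < ε ∧ IsGeodesicOn F η (Ioo (-ε) ε) ∧ curveLift (n := n) η 0 = p

/-- The geodesic `η` with `(η(0), η'(0)) = p` (its germ at `0` is unique when `p.2 ≠ 0`). -/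
def geodesicFrom (F : TangentBundle (𝓡 n) M → ℝ) (p : TangentBundle (𝓡 n) M) : ℝ → M :=
  haveI : Nonempty (ℝ → M) := ⟨fun _ => p.1⟩
  Classical.epsilon (IsGeodesicThrough F p)

/-! ### Smooth measures, S-curvature, the weighted Ricci curvature -/

/-- `σ` is a smooth positive density of `m` in the chart `φ`: `dm = σ dx¹ ⋯ dxⁿ`. -/
def IsDensity [MeasurableSpace M] (m : Measure M)
    (φ : OpenPartialHomeomorph M (EuclideanSpace ℝ (Fin n)))
    (σ : EuclideanSpace ℝ (Fin n) → ℝ) : Prop :=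
  ContDiffOn ℝ ∞ σ φ.target ∧ (∀ u ∈ φ.target, 0 < σ u) ∧
  ∀ A : Set M, MeasurableSet A → A ⊆ φ.source → m A = ∫⁻ u in φ '' A, ENNReal.ofReal (σ u)

/-- A smooth measure: it has a smooth positive density in every chart. -/
def IsSmoothMeasure (n : ℕ) {M : Type*} [TopologicalSpace M]
    [ChartedSpace (EuclideanSpace ℝ (Fin n)) M] [MeasurableSpace M] (m : Measure M) : Prop :=
  ∀ φ ∈ atlas (EuclideanSpace ℝ (Fin n)) M, ∃ σ, IsDensity m φ σ

/-- The density function of a smooth measure `m` in the chart `φ` (unique on the target of `φ`). -/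
def density [MeasurableSpace M] (m : Measure M)
    (φ : OpenPartialHomeomorph M (EuclideanSpace ℝ (Fin n))) : EuclideanSpace ℝ (Fin n) → ℝ :=
  Classical.epsilon (IsDensity m φ)

/-- The distortion `τ(x, y) = log (√det g_ij(x, y) / σ(x))`, computed in the chart around `x`. -/
def distortion [MeasurableSpace M] (F : TangentBundle (𝓡 n) M → ℝ) (m : Measure M)
    (p : TangentBundle (𝓡 n) M) : ℝ :=
  Real.log (Real.sqrt (gMatrix F (chartAt (EuclideanSpace ℝ (Fin n)) p.1)
      (coords (chartAt (EuclideanSpace ℝ (Fin n)) p.1) p)).det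
    / density m (chartAt (EuclideanSpace ℝ (Fin n)) p.1)
      (chartAt (EuclideanSpace ℝ (Fin n)) p.1 p.1))

/-- The S-curvature: the rate of change of the distortion along the geodesic `η` with
`(η(0), η'(0)) = p`. -/
def sCurvature [MeasurableSpace M] (F : TangentBundle (𝓡 n) M → ℝ) (m : Measure M)
    (p : TangentBundle (𝓡 n) M) : ℝ :=
  deriv (fun t => distortion F m (curveLift (geodesicFrom F p) t)) 0

/-- The rate of change of the S-curvature along the geodesic `η` with `(η(0), η'(0)) = p`. -/
def sCurvatureDot [MeasurableSpace M] (F : TangentBundle (𝓡 n) M → ℝ) (m : Measure M)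
    (p : TangentBundle (𝓡 n) M) : ℝ :=
  deriv (fun t => sCurvature F m (curveLift (geodesicFrom F p) t)) 0

/-- The weighted Ricci curvature `Ric_∞`. -/
def ricciInfty [MeasurableSpace M] (F : TangentBundle (𝓡 n) M → ℝ) (m : Measure M)
    (p : TangentBundle (𝓡 n) M) : ℝ :=
  ricci F p + sCurvatureDot F m p

/-- `Ric_∞ = κ` with respect to `m`, that is, `Ric_∞(x, y) = κ(x) F(x, y)²` for all `y ≠ 0`. -/
def RicciInftyEq [MeasurableSpace M] (F : TangentBundle (𝓡 n) M → ℝ) (m : Measure M)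
    (κ : M → ℝ) : Prop :=
  ∀ p : TangentBundle (𝓡 n) M, p.2 ≠ 0 → ricciInfty F m p = κ p.1 * F p ^ 2

/-! ### Gradient almost Ricci solitons -/

/-- A nowhere vanishing smooth geodesic field `Y` on the open set `U`: all its integral curves
in `U` are geodesics. Values of `Y` outside `U` are irrelevant. -/
structure IsGeodesicField [IsManifold (𝓡 n) ∞ M] (F : TangentBundle (𝓡 n) M → ℝ) (U : Set M)
    (Y : (x : M) → TangentSpace (𝓡 n) x) : Prop where
  isOpen : IsOpen U
  smoothOn : ContMDiffOn (𝓡 n) (𝓡 n).tangent ∞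
    (fun x => (⟨x, Y x⟩ : TangentBundle (𝓡 n) M)) U
  ne_zero : ∀ x ∈ U, Y x ≠ 0
  geodesic : ∀ (γ : ℝ → M) (a b : ℝ), (∀ t ∈ Ioo a b, γ t ∈ U) →
    IsMIntegralCurveOn γ Y (Ioo a b) → IsGeodesicOn F γ (Ioo a b)

/-- `(U, Y)` is a geodesic extension of the tangent vector `p = (x, y)`. -/
def IsGeodesicExtension [IsManifold (𝓡 n) ∞ M] (F : TangentBundle (𝓡 n) M → ℝ) (p : TangentBundle (𝓡 n) M)
    (U : Set M) (Y : (x : M) → TangentSpace (𝓡 n) x) : Prop :=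
  p.1 ∈ U ∧ IsGeodesicField F U Y ∧ Y p.1 = p.2

/-- The weight function `ψ` of `m` with respect to `g_Y`: `dm = e^{-ψ} dV_{g_Y}`, where in local
coordinates `dm = σ dx` and `dV_{g_Y} = √det g_ij(x, Y_x) dx`. -/
def weight [MeasurableSpace M] (F : TangentBundle (𝓡 n) M → ℝ) (m : Measure M)
    (Y : (x : M) → TangentSpace (𝓡 n) x) (x : M) : ℝ :=
  distortion F m ⟨x, Y x⟩

/-- The inner product `g_y(v, w) = g_ij(x, y) vⁱ wʲ` on `T_x M` for `p = (x, y)`. -/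
def fundamentalTensor (F : TangentBundle (𝓡 n) M → ℝ) (p : TangentBundle (𝓡 n) M)
    (v w : TangentSpace (𝓡 n) p.1) : ℝ :=
  ∑ i, ∑ j, gMatrix F (chartAt (EuclideanSpace ℝ (Fin n)) p.1)
      (coords (chartAt (EuclideanSpace ℝ (Fin n)) p.1) p) i j
    * (coords (chartAt (EuclideanSpace ℝ (Fin n)) p.1) ⟨p.1, v⟩).2 i
    * (coords (chartAt (EuclideanSpace ℝ (Fin n)) p.1) ⟨p.1, w⟩).2 j

/-- `v ∈ T_x M` is the gradient of `ψ` at `x` with respect to `g_Y`. -/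
def IsGradientAt (F : TangentBundle (𝓡 n) M → ℝ) (Y : (x : M) → TangentSpace (𝓡 n) x)
    (ψ : M → ℝ) (x : M) (v : TangentSpace (𝓡 n) x) : Prop :=
  ∀ w : TangentSpace (𝓡 n) x,
    fundamentalTensor F ⟨x, Y x⟩ v w = mfderiv (𝓡 n) 𝓘(ℝ, ℝ) ψ x w

/-- The components of the vector field `V` in the chart `φ`. -/
def fieldLoc (φ : OpenPartialHomeomorph M (EuclideanSpace ℝ (Fin n)))
    (V : (x : M) → TangentSpace (𝓡 n) x) (u : EuclideanSpace ℝ (Fin n)) :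
    EuclideanSpace ℝ (Fin n) :=
  (coords φ ⟨φ.symm u, V (φ.symm u)⟩).2

/-- The Lie derivative of `F²` along the complete lift
`V̂ = Vⁱ ∂/∂xⁱ + yʲ (∂Vⁱ/∂xʲ) ∂/∂yⁱ` of `V`, computed at `(x, y)` in the chart around `x`. -/
def lieSq (F : TangentBundle (𝓡 n) M → ℝ) (V : (x : M) → TangentSpace (𝓡 n) x)
    (p : TangentBundle (𝓡 n) M) : ℝ :=
  fderiv ℝ (sqLoc F (chartAt (EuclideanSpace ℝ (Fin n)) p.1))
    (coords (chartAt (EuclideanSpace ℝ (Fin n)) p.1) p)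
    (fieldLoc (chartAt (EuclideanSpace ℝ (Fin n)) p.1) V
        (coords (chartAt (EuclideanSpace ℝ (Fin n)) p.1) p).1,
      fderiv ℝ (fieldLoc (chartAt (EuclideanSpace ℝ (Fin n)) p.1) V)
        (coords (chartAt (EuclideanSpace ℝ (Fin n)) p.1) p).1
        (coords (chartAt (EuclideanSpace ℝ (Fin n)) p.1) p).2)

/-- `(M, F, m)` is a gradient almost Ricci soliton with soliton scalar `κ`: every `(x, y)`
with `y ≠ 0` has a geodesic extension `Y` and a `C²` vector field `V` on `M` that is near `x` the
`g_Y`-gradient of the weight function of `m`, such that `2 Ric + L_V̂(F²) = 2 κ F²` at `(x, y)`. -/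
def IsGradientAlmostRicciSoliton [IsManifold (𝓡 n) ∞ M] [MeasurableSpace M]
    (F : TangentBundle (𝓡 n) M → ℝ) (m : Measure M) (κ : M → ℝ) : Prop :=
  ∀ p : TangentBundle (𝓡 n) M, p.2 ≠ 0 →
    ∃ (U : Set M) (Y : (x : M) → TangentSpace (𝓡 n) x), IsGeodesicExtension F p U Y ∧
    ∃ V : (x : M) → TangentSpace (𝓡 n) x,
      ContMDiff (𝓡 n) (𝓡 n).tangent 2 (fun x => (⟨x, V x⟩ : TangentBundle (𝓡 n) M)) ∧
      (∀ᶠ x in 𝓝 p.1, IsGradientAt F Y (weight F m Y) x (V x)) ∧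
      2 * ricci F p + lieSq F V p = 2 * κ p.1 * F p ^ 2

/-- A gradient Ricci soliton with soliton constant `c`. -/
def IsGradientRicciSoliton [IsManifold (𝓡 n) ∞ M] [MeasurableSpace M]
    (F : TangentBundle (𝓡 n) M → ℝ) (m : Measure M) (c : ℝ) : Prop :=
  IsGradientAlmostRicciSoliton F m (fun _ => c)

end FinslerGeom

end

namespace FinslerGeom

/-! ### Superposition operators on spaces of continuous functions -/

section Superposition

universe u

variable {K : Type*} [TopologicalSpace K] [CompactSpace K]
variable {P Q : Type u} [NormedAddCommGroup P] [NormedSpace ℝ P]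
  [NormedAddCommGroup Q] [NormedSpace ℝ Q]

/-- Pointwise application of a continuous family of operators to a continuous function. -/
noncomputable def pointwiseApply : C(K, P →L[ℝ] Q) →L[ℝ] C(K, P) →L[ℝ] C(K, Q) :=
  LinearMap.mkContinuous₂
    (LinearMap.mk₂ ℝ (fun (A : C(K, P →L[ℝ] Q)) (x : C(K, P)) =>
        (⟨fun t => A t (x t), by fun_prop⟩ : C(K, Q)))
      (fun _ _ _ => by ext; simp) (fun _ _ _ => by ext; simp)
      (fun _ _ _ => by ext; simp) (fun _ _ _ => by ext; simp)) 1
    (fun A x => by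
      rw [one_mul]
      refine (ContinuousMap.norm_le _ (by positivity)).2 fun t => ?_
      exact ((A t).le_opNorm (x t)).trans
        (by gcongr; exacts [A.norm_coe_le_norm t, x.norm_coe_le_norm t]))

/-- The superposition operator `x ↦ g ∘ x`. -/
def superpose (g : C(P, Q)) (x : C(K, P)) : C(K, Q) := g.comp x

lemma hasFDerivAt_superpose (g : C(P, Q)) (g' : C(P, P →L[ℝ] Q))
    (hg : ∀ z, HasFDerivAt g (g' z) z) (x : C(K, P)) :
    HasFDerivAt (superpose (K := K) g) (pointwiseApply (superpose g' x)) x := by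
  rw [hasFDerivAt_iff_isLittleO_nhds_zero, Asymptotics.isLittleO_iff]
  intro ε hε
  have hc : Continuous (superpose (K := K) g') := ContinuousMap.continuous_postcomp g'
  obtain ⟨δ, hδ, hx⟩ := Metric.continuousAt_iff.1 (hc.continuousAt (x := x)) ε hε
  filter_upwards [Metric.ball_mem_nhds (0 : C(K, P)) hδ] with h hh
  rw [mem_ball_zero_iff] at hh
  refine (ContinuousMap.norm_le _ (by positivity)).2 fun t => ?_
  have key : ∀ z ∈ Metric.ball (x t) δ, ‖g' z - g' (x t)‖ ≤ ε := by
    intro z hz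
    have hd : dist (x + ContinuousMap.const K (z - x t)) x < δ := by
      rw [dist_eq_norm, add_sub_cancel_left]
      refine (ContinuousMap.norm_lt_iff _ hδ).2 fun s => ?_
      simpa [dist_eq_norm] using hz
    have := (ContinuousMap.dist_apply_le_dist t).trans (hx hd).le
    simpa [superpose, dist_eq_norm] using this
  have hmv := Convex.norm_image_sub_le_of_norm_hasFDerivWithin_le' (f := g) (f' := g')
    (φ := g' (x t)) (fun z _ => (hg z).hasFDerivWithinAt) key (convex_ball (x t) δ)
    (Metric.mem_ball_self hδ) (y := x t + h t)
    (by simpa [dist_eq_norm] using (h.norm_coe_le_norm t).trans_lt hh)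
  simp only [add_sub_cancel_left] at hmv
  exact hmv.trans (mul_le_mul_of_nonneg_left (h.norm_coe_le_norm t) hε.le)

lemma contDiff_superpose_nat (k : ℕ) : ∀ {P Q : Type u} [NormedAddCommGroup P] [NormedSpace ℝ P]
    [NormedAddCommGroup Q] [NormedSpace ℝ Q] (g : C(P, Q)), ContDiff ℝ k g →
    ContDiff ℝ k (superpose (K := K) g) := by
  induction k with
  | zero =>
    intro P Q _ _ _ _ g _
    exact contDiff_zero.2 (ContinuousMap.continuous_postcomp g)
  | succ k ih =>
    intro P Q _ _ _ _ g hg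
    have hd : Differentiable ℝ g := hg.differentiable (by simp)
    have hc : Continuous (fderiv ℝ g) := hg.continuous_fderiv (by simp)
    have h1 : ContDiff ℝ k (fderiv ℝ g) := hg.fderiv_right (by simp)
    rw [Nat.cast_succ, contDiff_succ_iff_hasFDerivAt]
    refine ⟨fun x => pointwiseApply (superpose ⟨fderiv ℝ g, hc⟩ x), ?_, fun x =>
      hasFDerivAt_superpose g ⟨fderiv ℝ g, hc⟩ (fun z => (hd z).hasFDerivAt) x⟩
    exact pointwiseApply.contDiff.comp (ih ⟨fderiv ℝ g, hc⟩ h1)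

lemma contDiff_superpose (g : C(P, Q)) (hg : ContDiff ℝ ∞ g) :
    ContDiff ℝ ∞ (superpose (K := K) g) :=
  contDiff_infty.2 fun k => contDiff_superpose_nat k g (hg.of_le (by exact_mod_cast le_top))

end Superposition

/-! ### Inverse function theorem on an open set -/

lemma exists_openPartialHomeomorph_contDiffOn {A B : Type*} [NormedAddCommGroup A]
    [NormedSpace ℝ A] [CompleteSpace A] [NormedAddCommGroup B] [NormedSpace ℝ B]
    {f : A → B} {W : Set A} (hW : IsOpen W) (hf : ContDiffOn ℝ ∞ f W) {a : A} (ha : a ∈ W)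
    (f' : A ≃L[ℝ] B) (hf' : HasFDerivAt f (f' : A →L[ℝ] B) a) :
    ∃ e : OpenPartialHomeomorph A B, (∀ x, e x = f x) ∧ a ∈ e.source ∧ e.source ⊆ W ∧
      ContDiffOn ℝ ∞ e.symm e.target := by
  have hcd : ∀ x ∈ W, ContDiffAt ℝ ∞ f x := fun x hx => hf.contDiffAt (hW.mem_nhds hx)
  have hfc : ContinuousOn (fderiv ℝ f) W := hf.continuousOn_fderiv_of_isOpen hW (by simp)
  let e₀ := (hcd a ha).toOpenPartialHomeomorph f hf' (by simp)
  let W' := W ∩ fderiv ℝ f ⁻¹' (range ((↑) : (A ≃L[ℝ] B) → (A →L[ℝ] B)))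
  have hW' : IsOpen W' := hfc.isOpen_inter_preimage hW ContinuousLinearEquiv.isOpen
  have haW' : a ∈ W' := ⟨ha, ⟨f', hf'.fderiv.symm⟩⟩
  have ha₀ : a ∈ e₀.source := (hcd a ha).mem_toOpenPartialHomeomorph_source hf' (by simp)
  refine ⟨e₀.restrOpen W' hW', fun x => rfl, ⟨ha₀, haW'⟩, fun x hx => hx.2.1, ?_⟩
  intro y hy
  refine ContDiffAt.contDiffWithinAt ?_
  have hx := (e₀.restrOpen W' hW').map_target hy
  obtain ⟨g, hg⟩ := hx.2.2
  refine OpenPartialHomeomorph.contDiffAt_symm _ hy (f₀' := g) ?_ (hcd _ hx.2.1)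
  rw [hg]
  exact ((hcd _ hx.2.1).differentiableAt (by simp)).hasFDerivAt

/-! ### Smooth dependence of solutions of ordinary differential equations -/

section Flow

set_option linter.unusedSectionVars false

universe u

variable {P : Type u} [NormedAddCommGroup P] [NormedSpace ℝ P] [CompleteSpace P]

/-- The extension of a continuous function on `[-1, 1]` to the real line by constants. -/
noncomputable def extendReal (x : C(Icc (-1 : ℝ) 1, P)) : ℝ → P :=
  IccExtend (by norm_num : (-1 : ℝ) ≤ 1) x

lemma continuous_extendReal (x : C(Icc (-1 : ℝ) 1, P)) : Continuous (extendReal x) :=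
  x.continuous.Icc_extend'

lemma extendReal_of_mem (x : C(Icc (-1 : ℝ) 1, P)) {t : ℝ} (ht : t ∈ Icc (-1 : ℝ) 1) :
    extendReal x t = x ⟨t, ht⟩ := IccExtend_of_mem _ _ ht

lemma norm_extendReal_le (x : C(Icc (-1 : ℝ) 1, P)) (t : ℝ) : ‖extendReal x t‖ ≤ ‖x‖ :=
  x.norm_coe_le_norm _

/-- The primitive vanishing at `0` of a continuous function on `[-1, 1]`. -/
noncomputable def primitive : C(Icc (-1 : ℝ) 1, P) →L[ℝ] C(Icc (-1 : ℝ) 1, P) :=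
  LinearMap.mkContinuous
    { toFun := fun x => ⟨fun t => ∫ s in (0 : ℝ)..t, extendReal x s,
        (intervalIntegral.continuous_primitive
          (fun a b => (continuous_extendReal x).intervalIntegrable a b) 0).comp
            continuous_subtype_val⟩
      map_add' := fun x y => by
        ext t
        exact intervalIntegral.integral_add ((continuous_extendReal x).intervalIntegrable _ _)
          ((continuous_extendReal y).intervalIntegrable _ _)
      map_smul' := fun c x => by
        ext t
        exact intervalIntegral.integral_smul c (extendReal x) } 1
    (fun x => by
      rw [one_mul]
      refine (ContinuousMap.norm_le _ (norm_nonneg _)).2 fun t => ?_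
      refine (intervalIntegral.norm_integral_le_of_norm_le_const
        (fun s _ => norm_extendReal_le x s)).trans ?_
      have : |(t : ℝ) - 0| ≤ 1 := by
        rw [sub_zero]
        exact abs_le.2 t.2
      exact mul_le_of_le_one_right (norm_nonneg _) this)

/-- `x` solves the equation `x' = s X(x)` on `[-1, 1]` with `x(0) = a`, where `q = (s, a)`. -/
def IsScaledSolution (X : C(P, P)) (q : ℝ × P) (x : C(Icc (-1 : ℝ) 1, P)) : Prop :=
  x = ContinuousMap.const _ q.2 + q.1 • primitive (superpose X x)

lemma IsScaledSolution.apply {X : C(P, P)} {q : ℝ × P} {x : C(Icc (-1 : ℝ) 1, P)}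
    (h : IsScaledSolution X q x) (t : Icc (-1 : ℝ) 1) :
    x t = q.2 + q.1 • ∫ s in (0 : ℝ)..t, X (extendReal x s) := by
  conv_lhs => rw [h]
  rfl

lemma IsScaledSolution.rescale {X : C(P, P)} {s : ℝ} {a : P} {x : C(Icc (-1 : ℝ) 1, P)}
    (h : IsScaledSolution X (s, a) x) {c : ℝ} (hc : c ∈ Icc (-1 : ℝ) 1) :
    IsScaledSolution X (s * c, a)
      ⟨fun t => extendReal x (t * c), by have := continuous_extendReal x; fun_prop⟩ := by
  ext t
  have hm : ∀ t ∈ Icc (-1 : ℝ) 1, t * c ∈ Icc (-1 : ℝ) 1 := fun t ht => by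
    rw [mem_Icc, ← abs_le] at hc ht ⊢
    rw [abs_mul]
    exact mul_le_one₀ ht (abs_nonneg _) hc
  have h1 := h.apply ⟨t * c, hm t t.2⟩
  change extendReal x (t * c) = a + (s * c) • ∫ r in (0 : ℝ)..t, X (extendReal _ r)
  rw [extendReal_of_mem x (hm t t.2), h1, mul_smul]
  congr 2
  have h2 := intervalIntegral.smul_integral_comp_mul_right (a := 0) (b := (t : ℝ))
    (fun r => X (extendReal x r)) c
  rw [zero_mul] at h2
  rw [← h2]
  congr 1
  refine intervalIntegral.integral_congr fun r hr => ?_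
  have hr' : r ∈ Icc (-1 : ℝ) 1 := by
    refine (uIcc_subset_Icc ?_ t.2) hr
    norm_num
  simp only [extendReal_of_mem _ hr', ContinuousMap.coe_mk]

lemma exists_smooth_family_of_solutions (X : C(P, P)) (hX : ContDiff ℝ ∞ X) (a₀ : P) :
    ∃ (N : Set (ℝ × P)) (ρ : ℝ) (sol : ℝ × P → C(Icc (-1 : ℝ) 1, P)), IsOpen N ∧ (0, a₀) ∈ N ∧
      ContDiffOn ℝ ∞ sol N ∧ (∀ q ∈ N, IsScaledSolution X q (sol q)) ∧
      (∀ q ∈ N, sol q ∈ Metric.ball (ContinuousMap.const _ a₀) ρ) ∧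
      ∀ q ∈ N, ∀ x ∈ Metric.ball (ContinuousMap.const _ a₀) ρ, IsScaledSolution X q x →
        x = sol q := by
  let cst : P →L[ℝ] C(Icc (-1 : ℝ) 1, P) := ContinuousLinearMap.const ℝ _
  let g : (ℝ × P) × C(Icc (-1 : ℝ) 1, P) → C(Icc (-1 : ℝ) 1, P) :=
    fun p => p.2 - cst p.1.2 - p.1.1 • primitive (superpose X p.2)
  have hN := contDiff_superpose (K := Icc (-1 : ℝ) 1) X hX
  have hg : ContDiff ℝ ∞ g := by
    refine (contDiff_snd.sub (cst.contDiff.comp contDiff_fst.snd)).sub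
      (contDiff_fst.fst.smul ((primitive (P := P)).contDiff.comp (hN.comp contDiff_snd)))
  let f : (ℝ × P) × C(Icc (-1 : ℝ) 1, P) → (ℝ × P) × C(Icc (-1 : ℝ) 1, P) := fun p => (p.1, g p)
  have hf : ContDiff ℝ ∞ f := contDiff_fst.prodMk hg
  let x₀ : C(Icc (-1 : ℝ) 1, P) := cst a₀
  let L : ℝ × P →L[ℝ] C(Icc (-1 : ℝ) 1, P) := -(cst.comp (ContinuousLinearMap.snd ℝ ℝ P)) -
    (ContinuousLinearMap.fst ℝ ℝ P).smulRight (primitive (superpose X x₀))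
  let f' : ((ℝ × P) × C(Icc (-1 : ℝ) 1, P)) ≃L[ℝ] ((ℝ × P) × C(Icc (-1 : ℝ) 1, P)) :=
    (ContinuousLinearEquiv.refl ℝ _).skewProd (ContinuousLinearEquiv.refl ℝ _) L
  have hf' : HasFDerivAt f (f' : _ →L[ℝ] _) ((0, a₀), x₀) := by
    have h1 : HasFDerivAt (fun p : (ℝ × P) × C(Icc (-1 : ℝ) 1, P) => p.1)
      (ContinuousLinearMap.fst ℝ _ _) ((0, a₀), x₀) := hasFDerivAt_fst
    have h2 : HasFDerivAt (fun p : (ℝ × P) × C(Icc (-1 : ℝ) 1, P) => p.2)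
      (ContinuousLinearMap.snd ℝ _ _) ((0, a₀), x₀) := hasFDerivAt_snd
    have h3 : DifferentiableAt ℝ (fun p : (ℝ × P) × C(Icc (-1 : ℝ) 1, P) =>
        primitive (superpose X p.2)) ((0, a₀), x₀) :=
      ((primitive (P := P)).contDiff.comp (hN.comp contDiff_snd)).differentiable (by simp) _
    have h4 := (h2.sub (cst.hasFDerivAt.comp _ h1.snd)).sub (h1.fst.smul h3.hasFDerivAt)
    refine (h1.prodMk h4).congr_fderiv ?_
    refine ContinuousLinearMap.ext fun ⟨⟨s, b⟩, x⟩ => Prod.ext rfl ?_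
    change x - cst b - ((0 : ℝ) • _ + s • primitive (superpose X x₀)) =
      x + (-(cst b) - s • primitive (superpose X x₀))
    rw [zero_smul]
    abel
  obtain ⟨e, he, hs, -, hsymm⟩ := exists_openPartialHomeomorph_contDiffOn isOpen_univ
    hf.contDiffOn (mem_univ _) f' hf'
  obtain ⟨ρ, hρ, hball⟩ := Metric.isOpen_iff.1 e.open_source _ hs
  have hf0 : f ((0, a₀), x₀) = ((0, a₀), 0) := by simp [f, g, x₀]
  have hsol : ∀ {q x}, IsScaledSolution X q x ↔ f (q, x) = (q, 0) := by
    intro q x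
    simp only [f, g, Prod.mk.injEq, true_and, sub_eq_zero, sub_sub]
    rfl
  let j : ℝ × P → (ℝ × P) × C(Icc (-1 : ℝ) 1, P) := fun q => (q, 0)
  have hj : ContDiff ℝ ∞ j := contDiff_id.prodMk contDiff_const
  let N₀ := j ⁻¹' e.target
  have hN₀ : IsOpen N₀ := e.open_target.preimage hj.continuous
  have hcd : ContDiffOn ℝ ∞ (fun q => e.symm (j q)) N₀ :=
    hsymm.comp hj.contDiffOn fun q hq => hq
  let N := N₀ ∩ (fun q => e.symm (j q)) ⁻¹' Metric.ball ((0, a₀), x₀) ρ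
  have hNo : IsOpen N := hcd.continuousOn.isOpen_inter_preimage hN₀ Metric.isOpen_ball
  have h0 : e.symm (j (0, a₀)) = ((0, a₀), x₀) := by
    change e.symm ((0, a₀), 0) = _
    rw [← hf0, ← he, e.left_inv hs]
  have h1 : ∀ q ∈ N, (e.symm (j q)).1 = q := fun q hq => by
    have := e.right_inv hq.1
    rw [he] at this
    exact congrArg Prod.fst this
  have h2 : ∀ q ∈ N, e.symm (j q) = (q, (e.symm (j q)).2) := fun q hq =>
    Prod.ext (h1 q hq) rfl
  have h3 : ∀ q ∈ N, f (q, (e.symm (j q)).2) = (q, 0) := fun q hq => by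
    rw [← h2 q hq, ← he, e.right_inv hq.1]
  refine ⟨N, ρ, fun q => (e.symm (j q)).2, hNo, ⟨?_, ?_⟩, ?_, ?_, ?_, ?_⟩
  · change ((0, a₀), 0) ∈ e.target
    rw [← hf0, ← he]
    exact e.map_source hs
  · rw [mem_preimage, h0]
    exact Metric.mem_ball_self hρ
  · exact contDiff_snd.comp_contDiffOn (hcd.mono inter_subset_left)
  · exact fun q hq => hsol.2 (h3 q hq)
  · intro q hq
    have := hq.2
    rw [mem_preimage, ← ball_prod_same] at this
    exact this.2
  · intro q hq x hx hxs
    have hq' := hq.2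
    rw [mem_preimage, ← ball_prod_same] at hq'
    have hqx : (q, x) ∈ e.source := hball (by
      rw [← ball_prod_same]
      exact ⟨by simpa only [h1 q hq] using hq'.1, hx⟩)
    have hqy : (q, (e.symm (j q)).2) ∈ e.source := by
      rw [← h2 q hq]
      exact e.map_target hq.1
    have := e.injOn hqx hqy (by rw [he, he, hsol.1 hxs, h3 q hq])
    exact congrArg Prod.snd this

theorem exists_smooth_flow (X : P → P) (hX : ContDiff ℝ ∞ X) (a₀ : P) :
    ∃ (Φ : ℝ × P → P) (N : Set (ℝ × P)), IsOpen N ∧ (0, a₀) ∈ N ∧ ContDiffOn ℝ ∞ Φ N ∧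
      (∀ a, (0, a) ∈ N → Φ (0, a) = a) ∧
      ∀ q ∈ N, HasDerivAt (fun s => Φ (s, q.2)) (X (Φ q)) q.1 := by
  obtain ⟨N, ρ, sol, hN, h0, hsm, hsol, hball, huniq⟩ :=
    exists_smooth_family_of_solutions ⟨X, hX.continuous⟩ hX a₀
  have hm1 : (1 : ℝ) ∈ Icc (-1 : ℝ) 1 := by norm_num
  refine ⟨fun q => sol q ⟨1, hm1⟩, N, hN, h0, ?_, ?_, ?_⟩
  · exact (ContinuousMap.evalCLM ℝ (⟨1, hm1⟩ : Icc (-1 : ℝ) 1)).contDiff.comp_contDiffOn hsm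
  · intro a ha
    simpa using (hsol _ ha).apply ⟨1, hm1⟩
  · rintro ⟨s, a⟩ hq
    have hopen : IsOpen ((fun r : ℝ => (r, a)) ⁻¹' N) := hN.preimage (by fun_prop)
    obtain ⟨ε, hε, hsub⟩ := Metric.isOpen_iff.1 hopen s hq
    obtain ⟨r, hr, hrs⟩ : ∃ r, (r, a) ∈ N ∧ |s| < |r| := by
      rcases le_or_gt 0 s with h | h
      · refine ⟨s + ε / 2, hsub ?_, ?_⟩
        · rw [Metric.mem_ball, Real.dist_eq, add_sub_cancel_left, abs_of_pos] <;> linarith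
        · rw [abs_of_nonneg h, abs_of_pos] <;> linarith
      · refine ⟨s - ε / 2, hsub ?_, ?_⟩
        · rw [Metric.mem_ball, Real.dist_eq, abs_of_neg] <;> linarith
        · rw [abs_of_neg h, abs_of_neg] <;> linarith
    have hr0 : r ≠ 0 := by
      rintro rfl
      simp only [abs_zero] at hrs
      exact absurd (abs_nonneg s) (not_le.2 hrs)
    have key : ∀ᶠ s' in 𝓝 s, sol (s', a) ⟨1, hm1⟩ = extendReal (sol (r, a)) (s' / r) ∧
        s' / r ∈ Icc (-1 : ℝ) 1 := by
      have hlt : ∀ᶠ s' in 𝓝 s, |s'| < |r| := continuous_abs.continuousAt.eventually_lt_const hrs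
      filter_upwards [hlt, hopen.mem_nhds hq] with s' hs' hN'
      have hc : s' / r ∈ Icc (-1 : ℝ) 1 := by
        rw [mem_Icc, ← abs_le, abs_div]
        exact div_le_one_of_le₀ hs'.le (abs_nonneg _)
      refine ⟨?_, hc⟩
      have hres := (hsol _ hr).rescale hc
      rw [mul_div_cancel₀ _ hr0] at hres
      have hmem := hball _ hr
      rw [← huniq _ hN' _ ?_ hres]
      · simp
      · rw [Metric.mem_ball, dist_eq_norm] at hmem ⊢
        refine lt_of_le_of_lt ?_ hmem
        refine (ContinuousMap.norm_le _ (norm_nonneg _)).2 fun t => ?_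
        exact (sol (r, a) - ContinuousMap.const _ a₀).norm_coe_le_norm _
    have hcont : Continuous fun t => X (extendReal (sol (r, a)) t) :=
      hX.continuous.comp (continuous_extendReal _)
    have hder : HasDerivAt (fun s' => a + r • ∫ t in (0 : ℝ)..(s' / r),
        X (extendReal (sol (r, a)) t)) (X (extendReal (sol (r, a)) (s / r))) s := by
      have h1 := (hcont.integral_hasStrictDerivAt 0 (s / r)).hasDerivAt
      have h2 := ((h1.scomp s ((hasDerivAt_id s).div_const r)).const_smul r).const_add a
      refine h2.congr_deriv ?_
      rw [smul_smul, mul_one_div_cancel hr0, one_smul]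
    have heq : (fun s' => sol (s', a) ⟨1, hm1⟩) =ᶠ[𝓝 s] fun s' => a + r • ∫ t in (0 : ℝ)..(s' / r),
        X (extendReal (sol (r, a)) t) := by
      filter_upwards [key] with s' hs'
      rw [hs'.1, extendReal_of_mem _ hs'.2, (hsol _ hr).apply]
      rfl
    have := hder.congr_of_eventuallyEq heq
    rwa [← key.self_of_nhds.1] at this

end Flow

section LocalFlow

universe u

/-- Smooth local flow of a vector field which is smooth near `a₀`. -/
theorem exists_smooth_flow_of_contDiffOn {P : Type u} [NormedAddCommGroup P] [NormedSpace ℝ P]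
    [FiniteDimensional ℝ P] {X : P → P} {O : Set P} (hO : IsOpen O) (hX : ContDiffOn ℝ ∞ X O)
    {a₀ : P} (ha₀ : a₀ ∈ O) :
    ∃ (Φ : ℝ × P → P) (N : Set (ℝ × P)), IsOpen N ∧ (0, a₀) ∈ N ∧ ContDiffOn ℝ ∞ Φ N ∧
      (∀ a, (0, a) ∈ N → Φ (0, a) = a) ∧ (∀ q ∈ N, Φ q ∈ O) ∧
      ∀ q ∈ N, HasDerivAt (fun s => Φ (s, q.2)) (X (Φ q)) q.1 := by
  have : CompleteSpace P := FiniteDimensional.complete ℝ P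
  obtain ⟨R, hR, hball⟩ := Metric.isOpen_iff.1 hO a₀ ha₀
  let b : ContDiffBump a₀ := ⟨R / 3, R / 2, by positivity, by linarith⟩
  have hb : ContDiff ℝ ∞ (fun z => b z • X z) := by
    rw [contDiff_iff_contDiffAt]
    intro z
    by_cases hz : z ∈ O
    · exact b.contDiff.contDiffAt.smul (hX.contDiffAt (hO.mem_nhds hz))
    · have hz' : z ∈ (Metric.closedBall a₀ (R / 2))ᶜ := fun h =>
        hz (hball (Metric.closedBall_subset_ball (by linarith) h))
      refine (contDiffAt_const (c := (0 : P))).congr_of_eventuallyEq ?_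
      filter_upwards [Metric.isClosed_closedBall.isOpen_compl.mem_nhds hz'] with w hw
      rw [b.zero_of_le_dist (le_of_lt (not_le.1 hw)), zero_smul]
  obtain ⟨Φ, N, hN, h0, hΦ, hinit, hder⟩ := exists_smooth_flow _ hb a₀
  have hΦ0 : Φ (0, a₀) = a₀ := hinit _ h0
  refine ⟨Φ, N ∩ Φ ⁻¹' Metric.ball a₀ (R / 3),
    hΦ.continuousOn.isOpen_inter_preimage hN Metric.isOpen_ball, ⟨h0, ?_⟩,
    hΦ.mono inter_subset_left, fun a ha => hinit a ha.1, ?_, ?_⟩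
  · rw [mem_preimage, hΦ0]
    exact Metric.mem_ball_self (by positivity)
  · exact fun q hq => hball (Metric.ball_subset_ball (by linarith) hq.2)
  · intro q hq
    have h1 := hder q hq.1
    rwa [b.one_of_mem_closedBall (Metric.ball_subset_closedBall hq.2), one_smul] at h1

/-- A second order equation `c'' = A(c, c')` has a smooth local field of solutions extending any
nonzero initial velocity. -/
theorem exists_local_field_of_second_order {E : Type u} [NormedAddCommGroup E] [NormedSpace ℝ E]
    [FiniteDimensional ℝ E] {A : E × E → E} {O : Set (E × E)} (hO : IsOpen O)
    (hA : ContDiffOn ℝ ∞ A O) {u₀ v₀ : E} (h₀ : (u₀, v₀) ∈ O) (hv₀ : v₀ ≠ 0) :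
    ∃ (U : Set E) (y : E → E), IsOpen U ∧ u₀ ∈ U ∧ ContDiffOn ℝ ∞ y U ∧ y u₀ = v₀ ∧
      ∀ u ∈ U, (u, y u) ∈ O ∧ fderiv ℝ y u (y u) = A (u, y u) := by
  have : CompleteSpace E := FiniteDimensional.complete ℝ E
  have hX : ContDiffOn ℝ ∞ (fun q : E × E => (q.2, A q)) O := contDiff_snd.contDiffOn.prodMk hA
  obtain ⟨Φ, N, hN, h0N, hΦ, hinit, hmem, hder⟩ := exists_smooth_flow_of_contDiffOn hO hX h₀
  obtain ⟨l, hl⟩ := SeparatingDual.exists_eq_one (R := ℝ) hv₀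
  let j' : E →L[ℝ] ℝ × (E × E) :=
    l.prod ((ContinuousLinearMap.id ℝ E - l.smulRight v₀).prod 0)
  let j : E → ℝ × (E × E) := fun z => (0, (u₀, v₀)) + j' z
  have hj : ∀ z, HasFDerivAt j j' z := fun z => j'.hasFDerivAt.const_add _
  have hjc : ContDiff ℝ ∞ j := contDiff_const.add j'.contDiff
  have hj0 : j 0 = (0, (u₀, v₀)) := by simp [j]
  have hjv : j' v₀ = (1, 0) := by
    simp only [j', ContinuousLinearMap.prod_apply, hl]
    ext <;> simp [hl]
  have hd : ∀ q ∈ N, HasFDerivAt Φ (fderiv ℝ Φ q) q := fun q hq =>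
    ((hΦ.contDiffAt (hN.mem_nhds hq)).differentiableAt (by simp)).hasFDerivAt
  have hd1 : ∀ q ∈ N, fderiv ℝ Φ q (1, 0) = ((Φ q).2, A (Φ q)) := by
    intro q hq
    have h1 : HasDerivAt (fun s : ℝ => (s, q.2)) (1, 0) q.1 :=
      (hasDerivAt_id q.1).prodMk (hasDerivAt_const _ _)
    exact ((hd q hq).comp_hasDerivAt q.1 h1).unique (hder q hq)
  have hd2 : ∀ b, fderiv ℝ Φ (0, (u₀, v₀)) (0, b) = b := by
    intro b
    have h1 : HasFDerivAt (fun a : E × E => ((0 : ℝ), a)) (ContinuousLinearMap.inr ℝ ℝ (E × E))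
      (u₀, v₀) := (ContinuousLinearMap.inr ℝ ℝ (E × E)).hasFDerivAt
    have h2 := (hd _ h0N).comp (u₀, v₀) h1
    have h3 : Φ ∘ (fun a : E × E => ((0 : ℝ), a)) =ᶠ[𝓝 (u₀, v₀)] id := by
      have hc : Continuous (fun a : E × E => ((0 : ℝ), a)) := by fun_prop
      filter_upwards [(hN.preimage hc).mem_nhds h0N] with a ha using hinit a ha
    have h4 := h2.unique ((hasFDerivAt_id _).congr_of_eventuallyEq h3)
    simpa using congrArg (fun T => T b) h4
  let N₁ := j ⁻¹' N
  have hN₁ : IsOpen N₁ := hN.preimage hjc.continuous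
  have h0N₁ : (0 : E) ∈ N₁ := by
    change j 0 ∈ N
    rwa [hj0]
  have hΨ : ContDiffOn ℝ ∞ (fun z => Φ (j z)) N₁ := hΦ.comp hjc.contDiffOn fun z hz => hz
  have hΨd : ∀ z ∈ N₁, HasFDerivAt (fun z => Φ (j z)) ((fderiv ℝ Φ (j z)).comp j') z :=
    fun z hz => (hd _ hz).comp z (hj z)
  have hΘ' : HasFDerivAt (fun z => (Φ (j z)).1)
      ((ContinuousLinearEquiv.refl ℝ E : E ≃L[ℝ] E) : E →L[ℝ] E) 0 := by
    refine (hΨd 0 h0N₁).fst.congr_fderiv ?_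
    refine ContinuousLinearMap.ext fun z => ?_
    have hz : j' z = l z • ((1 : ℝ), (0 : E × E)) + (0, (z - l z • v₀, 0)) := by
      ext <;> simp [j']
    have hΦ0 : Φ (0, (u₀, v₀)) = (u₀, v₀) := hinit _ h0N
    change (fderiv ℝ Φ (j 0) (j' z)).1 = z
    rw [hj0, hz, map_add, map_smul, hd1 _ h0N, hd2, hΦ0]
    simp
  obtain ⟨e, he, h0e, heN, hesymm⟩ := exists_openPartialHomeomorph_contDiffOn hN₁
    (contDiff_fst.comp_contDiffOn hΨ) h0N₁ (ContinuousLinearEquiv.refl ℝ E) hΘ'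
  have he0 : e 0 = u₀ := by
    rw [he]
    change (Φ (j 0)).1 = u₀
    rw [hj0, hinit _ h0N]
  have he0' : e.symm u₀ = 0 := by rw [← he0, e.left_inv h0e]
  have hy : ContDiffOn ℝ ∞ (fun u => (Φ (j (e.symm u))).2) e.target :=
    (contDiff_snd.comp_contDiffOn hΨ).comp hesymm fun u hu => heN (e.map_target hu)
  refine ⟨e.target, fun u => (Φ (j (e.symm u))).2, e.open_target, ?_, hy, ?_, ?_⟩
  · rw [← he0]
    exact e.map_source h0e
  · simp only [he0', hj0, hinit _ h0N]
  · intro u hu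
    set z := e.symm u with hz
    have hzs : z ∈ e.source := e.map_target hu
    have hzu : (Φ (j z)).1 = u := by
      have := e.right_inv hu
      rwa [he] at this
    have hΦz : Φ (j z) = (u, (Φ (j z)).2) := Prod.ext hzu rfl
    refine ⟨hΦz ▸ hmem _ (heN hzs), ?_⟩
    have h1 := hΨd z (heN hzs)
    have h2 : HasFDerivAt (fun u => (Φ (j (e.symm u))).2) _ u :=
      ((hy.contDiffAt (e.open_target.mem_nhds hu)).differentiableAt (by simp)).hasFDerivAt
    have h2' : HasFDerivAt (fun u => (Φ (j (e.symm u))).2)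
        (fderiv ℝ (fun u => (Φ (j (e.symm u))).2) u) ((Φ (j z)).1) := by rwa [hzu]
    have h3 := h2'.comp z h1.fst
    have h4 : (fun z => (Φ (j z)).2) =ᶠ[𝓝 z]
        (fun u => (Φ (j (e.symm u))).2) ∘ fun z => (Φ (j z)).1 := by
      filter_upwards [e.open_source.mem_nhds hzs] with w hw
      have hw' : e w = (Φ (j w)).1 := he w
      simp only [Function.comp_apply, ← hw', e.left_inv hw]
    have h5 := congrArg (fun T => T v₀) (h1.snd.unique (h3.congr_of_eventuallyEq h4))
    simp only [ContinuousLinearMap.comp_apply, ContinuousLinearMap.coe_fst',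
      ContinuousLinearMap.coe_snd', hjv, hd1 _ (heN hzs)] at h5
    rw [← h5, ← hΦz]

end LocalFlow

variable {n : ℕ}

/-! ### Calculus in local coordinates -/

section LocalCalculus

local notation "𝔼" n => EuclideanSpace ℝ (Fin n)

/-- The matrix `½ ∂²f/∂yⁱ∂yʲ` of a function `f(x, y)` of the local coordinates. -/
noncomputable def fiberHessian (f : (𝔼 n) × (𝔼 n) → ℝ) (q : (𝔼 n) × (𝔼 n)) :
    Matrix (Fin n) (Fin n) ℝ :=
  Matrix.of fun i j => (1 / 2 : ℝ) * dy i (dy j f) q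

/-- The geodesic coefficients of a function `f(x, y)` of the local coordinates. -/
noncomputable def localSpray (f : (𝔼 n) × (𝔼 n) → ℝ) (i : Fin n) (q : (𝔼 n) × (𝔼 n)) : ℝ :=
  (1 / 4 : ℝ) * ∑ l, (fiberHessian f q)⁻¹ i l *
    ((∑ m, dx m (dy l f) q * q.2 m) - dx l f q)

lemma euclidean_eq_sum (v : 𝔼 n) : v = ∑ i, v i • EuclideanSpace.single i (1 : ℝ) := by
  ext j
  simp [Finset.sum_apply, Pi.single_apply]

lemma clm_apply_eq_sum {F : Type*} [NormedAddCommGroup F] [NormedSpace ℝ F] (T : (𝔼 n) →L[ℝ] F)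
    (v : 𝔼 n) : T v = ∑ i, v i • T (EuclideanSpace.single i 1) := by
  conv_lhs => rw [euclidean_eq_sum v, map_sum]
  simp only [map_smul]

lemma clm_prod_apply_eq_sum (T : (𝔼 n) × (𝔼 n) →L[ℝ] ℝ) (v w : 𝔼 n) :
    T (v, w) = (∑ i, v i * T (EuclideanSpace.single i 1, 0)) +
      ∑ i, w i * T (0, EuclideanSpace.single i 1) := by
  have h1 := clm_apply_eq_sum (T.comp (ContinuousLinearMap.inl ℝ (𝔼 n) (𝔼 n))) v
  have h2 := clm_apply_eq_sum (T.comp (ContinuousLinearMap.inr ℝ (𝔼 n) (𝔼 n))) w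
  simp only [ContinuousLinearMap.comp_apply, ContinuousLinearMap.inl_apply,
    ContinuousLinearMap.inr_apply, smul_eq_mul] at h1 h2
  rw [← h1, ← h2, ← map_add, Prod.mk_add_mk, add_zero, zero_add]

lemma contDiffOn_dx {f : (𝔼 n) × (𝔼 n) → ℝ} {Ω : Set ((𝔼 n) × (𝔼 n))} (hΩ : IsOpen Ω)
    (hf : ContDiffOn ℝ ∞ f Ω) (i : Fin n) : ContDiffOn ℝ ∞ (dx i f) Ω :=
  (hf.fderiv_of_isOpen hΩ (by simp)).clm_apply contDiffOn_const

lemma contDiffOn_dy {f : (𝔼 n) × (𝔼 n) → ℝ} {Ω : Set ((𝔼 n) × (𝔼 n))} (hΩ : IsOpen Ω)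
    (hf : ContDiffOn ℝ ∞ f Ω) (i : Fin n) : ContDiffOn ℝ ∞ (dy i f) Ω :=
  (hf.fderiv_of_isOpen hΩ (by simp)).clm_apply contDiffOn_const

lemma hasFDerivAt_fderiv_apply {A : Type*} [NormedAddCommGroup A] [NormedSpace ℝ A]
    {f : A → ℝ} {q : A} (hf : ContDiffAt ℝ ∞ f q) (w : A) :
    HasFDerivAt (fun p => fderiv ℝ f p w) ((fderiv ℝ (fderiv ℝ f) q).flip w) q := by
  have h : HasFDerivAt (fderiv ℝ f) (fderiv ℝ (fderiv ℝ f) q) q :=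
    ((hf.fderiv_right (m := 1) (by norm_cast)).differentiableAt (by simp)).hasFDerivAt
  exact ((ContinuousLinearMap.apply ℝ ℝ w).hasFDerivAt (x := fderiv ℝ f q)).comp q h

lemma isSymmSndFDerivAt_of_contDiffAt {A B : Type*} [NormedAddCommGroup A] [NormedSpace ℝ A]
    [NormedAddCommGroup B] [NormedSpace ℝ B]
    {f : A → B} {q : A} (hf : ContDiffAt ℝ ∞ f q) (v w : A) :
    fderiv ℝ (fderiv ℝ f) q v w = fderiv ℝ (fderiv ℝ f) q w v :=
  (hf.isSymmSndFDerivAt (by simp; norm_cast)) v w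

lemma sum_fiberHessian_mul_mul {f : (𝔼 n) × (𝔼 n) → ℝ} {q : (𝔼 n) × (𝔼 n)}
    (hf : ContDiffAt ℝ ∞ f q) (v w : 𝔼 n) :
    ∑ i, ∑ j, fiberHessian f q i j * v i * w j =
      (1 / 2 : ℝ) * fderiv ℝ (fderiv ℝ f) q (0, v) (0, w) := by
  have h : ∀ i j, dy i (dy j f) q = fderiv ℝ (fderiv ℝ f) q (0, EuclideanSpace.single i 1)
      (0, EuclideanSpace.single j 1) := fun i j => by
    have := (hasFDerivAt_fderiv_apply hf (0, EuclideanSpace.single j 1)).fderiv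
    exact congrArg (fun T => T (0, EuclideanSpace.single i 1)) this
  have h1 := clm_apply_eq_sum ((fderiv ℝ (fderiv ℝ f) q).comp
    (ContinuousLinearMap.inr ℝ (𝔼 n) (𝔼 n))) v
  simp only [ContinuousLinearMap.comp_apply, ContinuousLinearMap.inr_apply] at h1
  rw [h1, sum_apply, Finset.mul_sum]
  refine Finset.sum_congr rfl fun i _ => ?_
  rw [clm_prod_apply_eq_sum]
  simp only [PiLp.zero_apply, zero_mul, Finset.sum_const_zero, zero_add, Finset.mul_sum]
  refine Finset.sum_congr rfl fun j _ => ?_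
  simp only [fiberHessian, Matrix.of_apply, h, smul_apply, smul_eq_mul]
  ring

lemma fiberHessian_apply {f : (𝔼 n) × (𝔼 n) → ℝ} {q : (𝔼 n) × (𝔼 n)}
    (hf : ContDiffAt ℝ ∞ f q) (i j : Fin n) :
    fiberHessian f q i j = (1 / 2 : ℝ) * fderiv ℝ (fderiv ℝ f) q (0, EuclideanSpace.single i 1)
      (0, EuclideanSpace.single j 1) := by
  rw [← sum_fiberHessian_mul_mul hf]
  simp

/-! ### The Euler–Lagrange equations -/

/-- The Euler–Lagrange equation of the energy `f` at the position and velocity `q` and the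
acceleration `a`. -/
def EulerLagrangeAt (f : (𝔼 n) × (𝔼 n) → ℝ) (q : (𝔼 n) × (𝔼 n)) (a : 𝔼 n) : Prop :=
  ∀ w, fderiv ℝ (fderiv ℝ f) q (q.2, a) (0, w) = fderiv ℝ f q (w, 0)

lemma four_mul_sum_fiberHessian_mul_localSpray {f : (𝔼 n) × (𝔼 n) → ℝ} {q : (𝔼 n) × (𝔼 n)}
    (hg : (fiberHessian f q).PosDef) (l : Fin n) :
    4 * ∑ j, fiberHessian f q l j * localSpray f j q =
      (∑ m, dx m (dy l f) q * q.2 m) - dx l f q := by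
  set b : Fin n → ℝ := fun l => (∑ m, dx m (dy l f) q * q.2 m) - dx l f q with hb
  have h1 : (fun j => localSpray f j q) = (1 / 4 : ℝ) • ((fiberHessian f q)⁻¹.mulVec b) := by
    ext j
    simp [localSpray, Matrix.mulVec, dotProduct, hb]
  have h2 : (fiberHessian f q).mulVec (fun j => localSpray f j q) = (1 / 4 : ℝ) • b := by
    rw [h1, Matrix.mulVec_smul, Matrix.mulVec_mulVec, Matrix.mul_nonsing_inv _
      (isUnit_iff_ne_zero.2 hg.det_pos.ne'), Matrix.one_mulVec]
  have h3 := congrFun h2 l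
  simp only [Matrix.mulVec, dotProduct, Pi.smul_apply, smul_eq_mul] at h3
  rw [h3]
  ring

lemma fderiv_dy_apply_eq {f : (𝔼 n) × (𝔼 n) → ℝ} {q : (𝔼 n) × (𝔼 n)}
    (hg : (fiberHessian f q).PosDef) (a : 𝔼 n) (l : Fin n) :
    fderiv ℝ (dy l f) q (q.2, a) =
      dx l f q + 2 * ∑ j, fiberHessian f q l j * (a j + 2 * localSpray f j q) := by
  have hs := four_mul_sum_fiberHessian_mul_localSpray hg l
  have h1 := clm_prod_apply_eq_sum (fderiv ℝ (dy l f) q) q.2 a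
  have h2 : ∀ j, fderiv ℝ (dy l f) q (0, EuclideanSpace.single j 1) =
      2 * fiberHessian f q l j := fun j => by
    have : fiberHessian f q l j = fiberHessian f q j l := by
      simpa using hg.isHermitian.apply j l
    rw [this]
    simp [fiberHessian, dy]
  have h3 : ∀ j, fderiv ℝ (dy l f) q (EuclideanSpace.single j 1, 0) = dx j (dy l f) q :=
    fun j => rfl
  simp only [h2, h3] at h1
  rw [h1]
  simp only [mul_add, Finset.sum_add_distrib]
  have h4 : ∑ i, q.2 i * dx i (dy l f) q = ∑ m, dx m (dy l f) q * q.2 m :=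
    Finset.sum_congr rfl fun _ _ => mul_comm _ _
  have h5 : ∑ i, a i * (2 * fiberHessian f q l i) = 2 * ∑ i, fiberHessian f q l i * a i := by
    rw [Finset.mul_sum]
    exact Finset.sum_congr rfl fun _ _ => by ring
  have h6 : ∑ i, fiberHessian f q l i * (2 * localSpray f i q) =
      2 * ∑ i, fiberHessian f q l i * localSpray f i q := by
    rw [Finset.mul_sum]
    exact Finset.sum_congr rfl fun _ _ => by ring
  rw [h4, h5, h6]
  linarith

lemma eulerLagrangeAt_iff {f : (𝔼 n) × (𝔼 n) → ℝ} {q : (𝔼 n) × (𝔼 n)}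
    (hf : ContDiffAt ℝ ∞ f q) (hg : (fiberHessian f q).PosDef) (a : 𝔼 n) :
    EulerLagrangeAt f q a ↔ ∀ i, a i + 2 * localSpray f i q = 0 := by
  have h0 : ∀ l, fderiv ℝ (dy l f) q (q.2, a) =
      fderiv ℝ (fderiv ℝ f) q (q.2, a) (0, EuclideanSpace.single l 1) := fun l => by
    have := (hasFDerivAt_fderiv_apply hf (0, EuclideanSpace.single l 1)).fderiv
    exact congrArg (fun T => T (q.2, a)) this
  constructor
  · intro h
    have h1 : (fiberHessian f q).mulVec (fun j => a j + 2 * localSpray f j q) = 0 := by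
      ext l
      have h2 := fderiv_dy_apply_eq hg a l
      rw [h0, h (EuclideanSpace.single l 1)] at h2
      change fderiv ℝ f q _ = fderiv ℝ f q _ + _ at h2
      have h3 : ∑ j, fiberHessian f q l j * (a j + 2 * localSpray f j q) = 0 := by linarith
      exact h3
    have h2 := Matrix.eq_zero_of_mulVec_eq_zero hg.det_pos.ne' h1
    exact fun i => congrFun h2 i
  · intro h w
    have h1 : ∀ l, fderiv ℝ (fderiv ℝ f) q (q.2, a) (0, EuclideanSpace.single l 1) =
        fderiv ℝ f q (EuclideanSpace.single l 1, 0) := fun l => by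
      rw [← h0, fderiv_dy_apply_eq hg a l]
      simp [h, dx]
    rw [clm_prod_apply_eq_sum _ 0 w, clm_prod_apply_eq_sum _ w 0]
    simp [h1]

/-- Along a solution of the Euler–Lagrange equations, the derivative of the momentum of a vector
field. -/
lemma EulerLagrangeAt.hasDerivAt {f : (𝔼 n) × (𝔼 n) → ℝ} {z : ℝ → (𝔼 n) × (𝔼 n)} {t : ℝ} {a : 𝔼 n}
    (h : EulerLagrangeAt f (z t) a) (hf : ContDiffAt ℝ ∞ f (z t))
    (hz : HasDerivAt z ((z t).2, a) t) {w : ℝ → 𝔼 n} {w' : 𝔼 n} (hw : HasDerivAt w w' t) :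
    HasDerivAt (fun s => fderiv ℝ f (z s) (0, w s)) (fderiv ℝ f (z t) (w t, w')) t := by
  have h1 : HasFDerivAt (fderiv ℝ f) (fderiv ℝ (fderiv ℝ f) (z t)) (z t) :=
    ((hf.fderiv_right (m := 1) (by norm_cast)).differentiableAt (by simp)).hasFDerivAt
  have h2 := h1.comp_hasDerivAt t hz
  have h3 : HasDerivAt (fun s => ((0 : 𝔼 n), w s)) (0, w') t := (hasDerivAt_const t _).prodMk hw
  refine (h2.clm_apply h3).congr_deriv ?_
  rw [h (w t), Function.comp_apply, ← map_add]
  simp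

/-! ### Change of coordinates -/

/-- The map induced by `T` on the coordinates of the tangent bundle. -/
noncomputable def tangentLift (T : (𝔼 n) → 𝔼 n) (q : (𝔼 n) × (𝔼 n)) : (𝔼 n) × (𝔼 n) :=
  (T q.1, fderiv ℝ T q.1 q.2)

lemma hasFDerivAt_fderiv_of_contDiffAt {A B : Type*} [NormedAddCommGroup A] [NormedSpace ℝ A]
    [NormedAddCommGroup B] [NormedSpace ℝ B] {f : A → B} {q : A} (hf : ContDiffAt ℝ ∞ f q) :
    HasFDerivAt (fderiv ℝ f) (fderiv ℝ (fderiv ℝ f) q) q :=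
  ((hf.fderiv_right (m := 1) (by norm_cast)).differentiableAt (by simp)).hasFDerivAt

lemma hasFDerivAt_tangentLift {T : (𝔼 n) → 𝔼 n} {q : (𝔼 n) × (𝔼 n)}
    (hT : ContDiffAt ℝ ∞ T q.1) :
    HasFDerivAt (tangentLift T) (((fderiv ℝ T q.1).comp (ContinuousLinearMap.fst ℝ (𝔼 n) (𝔼 n))).prod
      ((fderiv ℝ T q.1).comp (ContinuousLinearMap.snd ℝ (𝔼 n) (𝔼 n)) +
        ((fderiv ℝ (fderiv ℝ T) q.1).comp (ContinuousLinearMap.fst ℝ (𝔼 n) (𝔼 n))).flip q.2)) q := by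
  have h1 := ((hT.differentiableAt (by simp)).hasFDerivAt).comp q
    (hasFDerivAt_fst (𝕜 := ℝ) (E := 𝔼 n) (F := 𝔼 n) (p := q))
  have h2 := (hasFDerivAt_fderiv_of_contDiffAt hT).comp q
    (hasFDerivAt_fst (𝕜 := ℝ) (E := 𝔼 n) (F := 𝔼 n) (p := q))
  exact h1.prodMk (h2.clm_apply hasFDerivAt_snd)

section Transformation

variable {f f' : (𝔼 n) × (𝔼 n) → ℝ} {T : (𝔼 n) → 𝔼 n} {q : (𝔼 n) × (𝔼 n)}

lemma fderiv_comp_tangentLift (hT : ContDiffAt ℝ ∞ T q.1) (hf : ContDiffAt ℝ ∞ f (tangentLift T q))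
    (hff' : f' =ᶠ[𝓝 q] f ∘ tangentLift T) (v w : 𝔼 n) :
    fderiv ℝ f' q (v, w) = fderiv ℝ f (tangentLift T q)
      (fderiv ℝ T q.1 v, fderiv ℝ T q.1 w + fderiv ℝ (fderiv ℝ T) q.1 v q.2) := by
  have h1 := ((hf.differentiableAt (by simp)).hasFDerivAt).comp q (hasFDerivAt_tangentLift hT)
  rw [(h1.congr_of_eventuallyEq hff').fderiv]
  rfl

lemma fderiv_fderiv_comp_tangentLift (hT : ContDiffAt ℝ ∞ T q.1)
    (hf : ContDiffAt ℝ ∞ f (tangentLift T q)) (hf' : ContDiffAt ℝ ∞ f' q)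
    (hff' : f' =ᶠ[𝓝 q] f ∘ tangentLift T) (v a w : 𝔼 n) :
    fderiv ℝ (fderiv ℝ f') q (v, a) (0, w) =
      fderiv ℝ (fderiv ℝ f) (tangentLift T q)
        (fderiv ℝ T q.1 v, fderiv ℝ T q.1 a + fderiv ℝ (fderiv ℝ T) q.1 v q.2)
        (0, fderiv ℝ T q.1 w) +
      fderiv ℝ f (tangentLift T q) (0, fderiv ℝ (fderiv ℝ T) q.1 v w) := by
  have hΨ := hasFDerivAt_tangentLift hT
  have h1 : (fun p => fderiv ℝ f' p (0, w)) =ᶠ[𝓝 q]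
      fun p => fderiv ℝ f (tangentLift T p) (0, fderiv ℝ T p.1 w) := by
    have e1 : ∀ᶠ p in 𝓝 q, DifferentiableAt ℝ f (tangentLift T p) := by
      have := (hf.of_le (m := 1) (by norm_cast)).eventually (by simp)
      exact (hΨ.continuousAt.eventually this).mono fun p hp => hp.differentiableAt (by simp)
    have e2 : ∀ᶠ p in 𝓝 q, ContDiffAt ℝ 2 T p.1 :=
      continuousAt_fst.eventually ((hT.of_le (m := 2) (by norm_cast)).eventually (by simp))
    filter_upwards [e1, e2, hff'.eventuallyEq_nhds] with p hp1 hp2 hp3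
    have d1 := ((hp2.differentiableAt (by simp)).hasFDerivAt).comp p
      (hasFDerivAt_fst (𝕜 := ℝ) (E := 𝔼 n) (F := 𝔼 n) (p := p))
    have d2 := (((hp2.fderiv_right (m := 1) (by norm_num)).differentiableAt
      (by simp)).hasFDerivAt).comp p (hasFDerivAt_fst (𝕜 := ℝ) (E := 𝔼 n) (F := 𝔼 n) (p := p))
    have d3 : HasFDerivAt (tangentLift T) _ p := d1.prodMk (d2.clm_apply hasFDerivAt_snd)
    rw [((hp1.hasFDerivAt.comp p d3).congr_of_eventuallyEq hp3).fderiv]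
    simp
  have h2 := (hasFDerivAt_fderiv_of_contDiffAt hf).comp q hΨ
  have h3 := (hasFDerivAt_fderiv_of_contDiffAt hT).comp q
    (hasFDerivAt_fst (𝕜 := ℝ) (E := 𝔼 n) (F := 𝔼 n) (p := q))
  have h4 : HasFDerivAt (fun p : (𝔼 n) × (𝔼 n) => ((0 : 𝔼 n), fderiv ℝ T p.1 w)) _ q :=
    (hasFDerivAt_const (0 : 𝔼 n) q).prodMk (h3.clm_apply (hasFDerivAt_const w q))
  have h5 := (h2.clm_apply h4).congr_of_eventuallyEq h1
  have h6 := (hasFDerivAt_fderiv_apply hf' (0, w)).unique h5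
  have h7 := congrArg (fun S => S (v, a)) h6
  simp only [ContinuousLinearMap.flip_apply] at h7
  rw [h7]
  simp [add_comm]

lemma EulerLagrangeAt.comp_tangentLift {a : 𝔼 n} (hT : ContDiffAt ℝ ∞ T q.1)
    (hf : ContDiffAt ℝ ∞ f (tangentLift T q)) (hf' : ContDiffAt ℝ ∞ f' q)
    (hff' : f' =ᶠ[𝓝 q] f ∘ tangentLift T)
    (h : EulerLagrangeAt f (tangentLift T q)
      (fderiv ℝ T q.1 a + fderiv ℝ (fderiv ℝ T) q.1 q.2 q.2)) :
    EulerLagrangeAt f' q a := by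
  intro w
  rw [fderiv_fderiv_comp_tangentLift hT hf hf' hff', fderiv_comp_tangentLift hT hf hff']
  have h1 := h (fderiv ℝ T q.1 w)
  change fderiv ℝ (fderiv ℝ f) _ (fderiv ℝ T q.1 q.2, _) _ = _ at h1
  rw [h1, ← map_add, isSymmSndFDerivAt_of_contDiffAt hT q.2 w]
  simp

lemma fderiv_fderiv_comp_tangentLift_vertical (hT : ContDiffAt ℝ ∞ T q.1)
    (hf : ContDiffAt ℝ ∞ f (tangentLift T q)) (hf' : ContDiffAt ℝ ∞ f' q)
    (hff' : f' =ᶠ[𝓝 q] f ∘ tangentLift T) (v w : 𝔼 n) :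
    fderiv ℝ (fderiv ℝ f') q (0, v) (0, w) = fderiv ℝ (fderiv ℝ f) (tangentLift T q)
      (0, fderiv ℝ T q.1 v) (0, fderiv ℝ T q.1 w) := by
  rw [fderiv_fderiv_comp_tangentLift hT hf hf' hff']
  simp only [map_zero, zero_apply, add_zero, add_eq_left]
  exact map_zero (fderiv ℝ f (tangentLift T q))

lemma det_fiberHessian_comp_tangentLift (hT : ContDiffAt ℝ ∞ T q.1)
    (hf : ContDiffAt ℝ ∞ f (tangentLift T q)) (hf' : ContDiffAt ℝ ∞ f' q)
    (hff' : f' =ᶠ[𝓝 q] f ∘ tangentLift T) :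
    (fiberHessian f' q).det = (fderiv ℝ T q.1).det ^ 2 *
      (fiberHessian f (tangentLift T q)).det := by
  let b := (EuclideanSpace.basisFun (Fin n) ℝ).toBasis
  let J := LinearMap.toMatrix b b (fderiv ℝ T q.1 : (𝔼 n) →ₗ[ℝ] 𝔼 n)
  have hJ : ∀ i j, J i j = fderiv ℝ T q.1 (EuclideanSpace.single j 1) i := fun i j => by
    simp [J, b, LinearMap.toMatrix_apply]
  have h1 : fiberHessian f' q = J.transpose * fiberHessian f (tangentLift T q) * J := by
    ext i j
    rw [fiberHessian_apply hf', fderiv_fderiv_comp_tangentLift_vertical hT hf hf' hff',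
      ← sum_fiberHessian_mul_mul hf]
    simp only [Matrix.mul_apply, Matrix.transpose_apply, hJ, Finset.sum_mul]
    rw [Finset.sum_comm]
    exact Finset.sum_congr rfl fun k _ => Finset.sum_congr rfl fun l _ => by ring
  have hdet : J.det = (fderiv ℝ T q.1).det := LinearMap.det_toMatrix b _
  rw [h1, Matrix.det_mul, Matrix.det_mul, Matrix.det_transpose, hdet]
  ring

end Transformation

/-! ### Homogeneity -/

/-- Euler's theorem for the vertical derivative of a function which is `2`-homogeneous in `y`. -/
lemma fderiv_fderiv_vertical_of_homogeneous {f : (𝔼 n) × (𝔼 n) → ℝ} {q : (𝔼 n) × (𝔼 n)}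
    (hf : ContDiffAt ℝ ∞ f q) (hom : ∀ᶠ p in 𝓝 q, ∀ c : ℝ, 0 < c → f (p.1, c • p.2) = c ^ 2 * f p)
    (w : 𝔼 n) : fderiv ℝ (fderiv ℝ f) q (0, q.2) (0, w) = fderiv ℝ f q (0, w) := by
  let S : ℝ → (𝔼 n) × (𝔼 n) →L[ℝ] (𝔼 n) × (𝔼 n) := fun c =>
    (ContinuousLinearMap.fst ℝ _ _).prod (c • ContinuousLinearMap.snd ℝ _ _)
  have hS : HasDerivAt (fun c : ℝ => S c q) (0, q.2) 1 := by
    refine (hasDerivAt_const (1 : ℝ) q.1).prodMk ?_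
    simpa using (hasDerivAt_id (1 : ℝ)).smul_const q.2
  have hS1 : S 1 q = q := by simp [S]
  have h0 : ∀ᶠ c in 𝓝 (1 : ℝ), fderiv ℝ f (S c q) (0, w) = c * fderiv ℝ f q (0, w) := by
    have e1 : ∀ᶠ c in 𝓝 (1 : ℝ), DifferentiableAt ℝ f (S c q) := by
      have h1 := (hf.of_le (m := 1) (by norm_cast)).eventually (by simp)
      rw [← hS1] at h1
      exact (hS.continuousAt.eventually h1).mono fun p hp => hp.differentiableAt (by simp)
    filter_upwards [e1, lt_mem_nhds one_pos] with c hc hc0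
    have h2 := hc.hasFDerivAt.comp q (S c).hasFDerivAt
    have h3 : (f ∘ S c) =ᶠ[𝓝 q] fun p => c ^ 2 * f p := hom.mono fun p hp => hp c hc0
    have h4 := ((hf.differentiableAt (by simp)).hasFDerivAt.const_mul (c ^ 2))
    have h5 := congrArg (fun A => A (0, w)) (h2.unique (h4.congr_of_eventuallyEq h3))
    have h6 : S c (0, w) = c • ((0 : 𝔼 n), w) := by simp [S]
    simp only [ContinuousLinearMap.comp_apply, h6, map_smul, smul_apply,
      smul_eq_mul] at h5
    have hc' : c ≠ 0 := hc0.ne'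
    apply mul_left_cancel₀ hc'
    rw [h5]
    ring
  have hf1 : ContDiffAt ℝ ∞ f (S 1 q) := by rwa [hS1]
  have h7 := (hasFDerivAt_fderiv_apply hf1 (0, w)).comp_hasDerivAt (1 : ℝ) hS
  have h8 : HasDerivAt (fun c : ℝ => c * fderiv ℝ f q (0, w)) (fderiv ℝ f q (0, w)) 1 := by
    simpa using (hasDerivAt_id (1 : ℝ)).mul_const (fderiv ℝ f q (0, w))
  have h9 := h7.unique (h8.congr_of_eventuallyEq h0)
  rw [hS1] at h9
  exact h9

/-! ### Smoothness of matrix operations -/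

lemma contDiffOn_det {A : Type*} [NormedAddCommGroup A] [NormedSpace ℝ A] {Ω : Set A}
    {B : A → Matrix (Fin n) (Fin n) ℝ} (hB : ∀ i j, ContDiffOn ℝ ∞ (fun a => B a i j) Ω) :
    ContDiffOn ℝ ∞ (fun a => (B a).det) Ω := by
  simp only [Matrix.det_apply']
  exact ContDiffOn.sum fun σ _ => contDiffOn_const.mul (contDiffOn_prod fun i _ => hB _ _)

lemma contDiffOn_inv_apply {A : Type*} [NormedAddCommGroup A] [NormedSpace ℝ A] {Ω : Set A}
    {B : A → Matrix (Fin n) (Fin n) ℝ} (hB : ∀ i j, ContDiffOn ℝ ∞ (fun a => B a i j) Ω)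
    (hdet : ∀ a ∈ Ω, (B a).det ≠ 0) (i j : Fin n) :
    ContDiffOn ℝ ∞ (fun a => (B a)⁻¹ i j) Ω := by
  simp only [Matrix.inv_def, Matrix.smul_apply, Ring.inverse_eq_inv', smul_eq_mul,
    Matrix.adjugate_apply]
  refine ((contDiffOn_det hB).inv hdet).mul (contDiffOn_det fun k l => ?_)
  by_cases hk : k = j
  · subst hk
    simp only [Matrix.updateRow_self]
    exact contDiffOn_const
  · simp only [Matrix.updateRow_ne hk]
    exact hB k l

lemma contDiffOn_fiberHessian {f : (𝔼 n) × (𝔼 n) → ℝ} {Ω : Set ((𝔼 n) × (𝔼 n))} (hΩ : IsOpen Ω)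
    (hf : ContDiffOn ℝ ∞ f Ω) (i j : Fin n) : ContDiffOn ℝ ∞ (fun q => fiberHessian f q i j) Ω :=
  contDiffOn_const.mul (contDiffOn_dy hΩ (contDiffOn_dy hΩ hf j) i)

lemma contDiffOn_localSpray {f : (𝔼 n) × (𝔼 n) → ℝ} {Ω : Set ((𝔼 n) × (𝔼 n))} (hΩ : IsOpen Ω)
    (hf : ContDiffOn ℝ ∞ f Ω) (hg : ∀ q ∈ Ω, (fiberHessian f q).PosDef) (i : Fin n) :
    ContDiffOn ℝ ∞ (localSpray f i) Ω := by
  refine contDiffOn_const.mul (ContDiffOn.sum fun l _ => ?_)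
  refine (contDiffOn_inv_apply (contDiffOn_fiberHessian hΩ hf)
    (fun q hq => (hg q hq).det_pos.ne') i l).mul (ContDiffOn.sub (ContDiffOn.sum fun k _ => ?_)
      (contDiffOn_dx hΩ hf l))
  refine (contDiffOn_dx hΩ (contDiffOn_dy hΩ hf l) k).mul ?_
  have : ContDiff ℝ ∞ fun q : (𝔼 n) × (𝔼 n) => q.2 k := by fun_prop
  exact this.contDiffOn

end LocalCalculus

section Charts

set_option linter.unusedSectionVars false

variable {n : ℕ} {M : Type*} [TopologicalSpace M] [ChartedSpace (EuclideanSpace ℝ (Fin n)) M]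
  [IsManifold (𝓡 n) ∞ M]

local notation "𝔼" n => EuclideanSpace ℝ (Fin n)

/-! ### Coordinates on the tangent bundle -/

variable {φ φ' : OpenPartialHomeomorph M (𝔼 n)}

lemma mdifferentiable_chart (hφ : φ ∈ atlas (𝔼 n) M) : φ.MDifferentiable (𝓡 n) (𝓡 n) := by
  have : IsManifold (𝓡 n) 1 M := IsManifold.of_le (n := ∞) (by norm_cast)
  exact mdifferentiable_of_mem_atlas hφ

lemma coords_ofCoords (hφ : φ ∈ atlas (𝔼 n) M) {q : (𝔼 n) × (𝔼 n)} (hq : q.1 ∈ φ.target) :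
    coords φ (ofCoords φ q) = q := by
  refine Prod.ext (φ.right_inv hq) ?_
  exact congrArg (fun A => A q.2) ((mdifferentiable_chart hφ).comp_symm_deriv hq)

lemma totalSpace_mk_eq {x x' : M} (h : x = x') (v v' : 𝔼 n) (hv : v = v') :
    (⟨x, v⟩ : TangentBundle (𝓡 n) M) = ⟨x', v'⟩ := by
  subst h hv
  rfl

lemma ofCoords_coords (hφ : φ ∈ atlas (𝔼 n) M) {p : TangentBundle (𝓡 n) M}
    (hp : p.1 ∈ φ.source) : ofCoords φ (coords φ p) = p :=
  totalSpace_mk_eq (φ.left_inv hp) _ _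
    (congrArg (fun A => A p.2) ((mdifferentiable_chart hφ).symm_comp_deriv hp))

lemma ofCoords_snd_ne_zero (hφ : φ ∈ atlas (𝔼 n) M) {q : (𝔼 n) × (𝔼 n)} (hq : q.1 ∈ φ.target)
    (h : q.2 ≠ 0) : (ofCoords φ q).2 ≠ 0 := by
  intro h0
  apply h
  have h1 := congrArg Prod.snd (coords_ofCoords hφ hq)
  rw [← h1]
  simp only [coords, h0, map_zero]
  rfl

lemma coords_snd_ne_zero (hφ : φ ∈ atlas (𝔼 n) M) {p : TangentBundle (𝓡 n) M}
    (hp : p.1 ∈ φ.source) (h : p.2 ≠ 0) : (coords φ p).2 ≠ 0 := by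
  intro h0
  apply h
  apply (mdifferentiable_chart hφ).mfderiv_injective hp
  rw [map_zero]
  exact h0

lemma contDiffAt_transition (hφ : φ ∈ atlas (𝔼 n) M) (hφ' : φ' ∈ atlas (𝔼 n) M) {u : 𝔼 n}
    (hu : u ∈ φ'.target) (hu' : φ'.symm u ∈ φ.source) : ContDiffAt ℝ ∞ (φ ∘ φ'.symm) u := by
  rw [← contMDiffAt_iff_contDiffAt]
  exact (contMDiffAt_of_mem_maximalAtlas (IsManifold.subset_maximalAtlas hφ) hu').comp u
    (contMDiffAt_symm_of_mem_maximalAtlas (IsManifold.subset_maximalAtlas hφ') hu)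

lemma coords_eq_tangentLift (hφ : φ ∈ atlas (𝔼 n) M) (hφ' : φ' ∈ atlas (𝔼 n) M)
    {p : TangentBundle (𝓡 n) M} (hp : p.1 ∈ φ.source) (hp' : p.1 ∈ φ'.source) :
    coords φ p = tangentLift (φ ∘ φ'.symm) (coords φ' p) := by
  have h1 : φ'.symm (φ' p.1) = p.1 := φ'.left_inv hp'
  refine Prod.ext ?_ ?_
  · simp [coords, tangentLift, h1]
  · change mfderiv (𝓡 n) (𝓡 n) φ p.1 p.2 =
      fderiv ℝ (φ ∘ φ'.symm) (φ' p.1) (mfderiv (𝓡 n) (𝓡 n) φ' p.1 p.2)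
    have h2 : HasMFDerivAt (𝓡 n) (𝓡 n) φ p.1 (mfderiv (𝓡 n) (𝓡 n) φ p.1) :=
      ((mdifferentiable_chart hφ).mdifferentiableAt hp).hasMFDerivAt
    have h3 : HasMFDerivAt (𝓡 n) (𝓡 n) φ' p.1 (mfderiv (𝓡 n) (𝓡 n) φ' p.1) :=
      ((mdifferentiable_chart hφ').mdifferentiableAt hp').hasMFDerivAt
    have h4 : ContDiffAt ℝ ∞ (φ ∘ φ'.symm) (φ' p.1) :=
      contDiffAt_transition hφ hφ' (φ'.map_source hp') (by rwa [h1])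
    have h5 := (h4.differentiableAt (by simp)).hasFDerivAt.hasMFDerivAt
    have h6 := h5.comp p.1 h3
    have h7 : φ =ᶠ[𝓝 p.1] (φ ∘ φ'.symm) ∘ φ' := by
      filter_upwards [φ'.open_source.mem_nhds hp'] with x hx
      simp [φ'.left_inv hx]
    have h8 := hasMFDerivAt_unique h2 (h6.congr_of_eventuallyEq h7)
    exact congrArg (fun A => A p.2) h8

lemma ofCoords_tangentLift (hφ : φ ∈ atlas (𝔼 n) M) (hφ' : φ' ∈ atlas (𝔼 n) M)
    {q : (𝔼 n) × (𝔼 n)} (hq : q.1 ∈ φ'.target) (hq' : φ'.symm q.1 ∈ φ.source) :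
    ofCoords φ (tangentLift (φ ∘ φ'.symm) q) = ofCoords φ' q := by
  have h1 := coords_eq_tangentLift hφ hφ' (p := ofCoords φ' q) hq' (φ'.map_target hq)
  rw [coords_ofCoords hφ' hq] at h1
  rw [← h1, ofCoords_coords hφ hq']

lemma sqLoc_eventuallyEq (F : TangentBundle (𝓡 n) M → ℝ) (hφ : φ ∈ atlas (𝔼 n) M)
    (hφ' : φ' ∈ atlas (𝔼 n) M) {q : (𝔼 n) × (𝔼 n)} (hq : q.1 ∈ φ'.target)
    (hq' : φ'.symm q.1 ∈ φ.source) :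
    sqLoc F φ' =ᶠ[𝓝 q] sqLoc F φ ∘ tangentLift (φ ∘ φ'.symm) := by
  have ho : IsOpen (φ'.target ∩ φ'.symm ⁻¹' φ.source) :=
    φ'.isOpen_inter_preimage_symm φ.open_source
  filter_upwards [continuousAt_fst.eventually (ho.mem_nhds ⟨hq, hq'⟩)] with r hr
  simp only [sqLoc, Function.comp_apply, ofCoords_tangentLift hφ hφ' hr.1 hr.2]

/-! ### Smoothness of coordinates -/

lemma contMDiffOn_ofCoords (hφ : φ ∈ atlas (𝔼 n) M) :
    ContMDiffOn 𝓘(ℝ, (𝔼 n) × (𝔼 n)) (𝓡 n).tangent ∞ (ofCoords φ) (φ.target ×ˢ univ) := by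
  have : IsManifold (𝓡 n) 1 M := IsManifold.of_le (n := ∞) (by norm_cast)
  have h1 : ContMDiffOn (𝓡 n) (𝓡 n) ∞ φ.symm φ.target :=
    contMDiffOn_symm_of_mem_maximalAtlas (IsManifold.subset_maximalAtlas hφ)
  have h2 := h1.contMDiffOn_tangentMapWithin (m := ∞) (by simp) φ.open_target.uniqueMDiffOn
  have h3 : ContMDiff 𝓘(ℝ, (𝔼 n) × (𝔼 n)) (𝓡 n).tangent ∞
      (fun q : (𝔼 n) × (𝔼 n) => (⟨q.1, q.2⟩ : TangentBundle (𝓡 n) (𝔼 n))) := by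
    have h := contMDiff_tangentBundleModelSpaceHomeomorph_symm (I := 𝓡 n) (n := ∞)
    rw [show 𝓘(ℝ, (𝔼 n) × (𝔼 n)) = (𝓡 n).tangent from modelWithCornersSelf_prod]
    exact h
  refine (h2.comp h3.contMDiffOn (s := φ.target ×ˢ univ) fun q hq => hq.1).congr ?_
  intro q hq
  simp only [Function.comp_apply, tangentMapWithin, ofCoords]
  rw [mfderivWithin_of_isOpen φ.open_target hq.1]

lemma contMDiffOn_coords (hφ : φ ∈ atlas (𝔼 n) M) :
    ContMDiffOn (𝓡 n).tangent 𝓘(ℝ, (𝔼 n) × (𝔼 n)) ∞ (coords φ) {p | p.1 ∈ φ.source} := by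
  have : IsManifold (𝓡 n) 1 M := IsManifold.of_le (n := ∞) (by norm_cast)
  have h1 : ContMDiffOn (𝓡 n) (𝓡 n) ∞ φ φ.source :=
    contMDiffOn_of_mem_maximalAtlas (IsManifold.subset_maximalAtlas hφ)
  have h2 := h1.contMDiffOn_tangentMapWithin (m := ∞) (by simp) φ.open_source.uniqueMDiffOn
  have h3 : ContMDiff (𝓡 n).tangent 𝓘(ℝ, (𝔼 n) × (𝔼 n)) ∞
      (fun q : TangentBundle (𝓡 n) (𝔼 n) => ((q.1, q.2) : (𝔼 n) × (𝔼 n))) := by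
    have h := contMDiff_tangentBundleModelSpaceHomeomorph (I := 𝓡 n) (n := ∞)
    rw [show 𝓘(ℝ, (𝔼 n) × (𝔼 n)) = (𝓡 n).tangent from modelWithCornersSelf_prod]
    exact h
  refine (h3.comp_contMDiffOn h2).congr ?_
  intro p hp
  simp only [Function.comp_apply, tangentMapWithin, coords]
  rw [mfderivWithin_of_isOpen φ.open_source hp]

/-- The domain of the coordinates of nonzero tangent vectors. -/
def slitDomain (φ : OpenPartialHomeomorph M (𝔼 n)) : Set ((𝔼 n) × (𝔼 n)) := φ.target ×ˢ {0}ᶜ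

lemma isOpen_slitDomain (φ : OpenPartialHomeomorph M (𝔼 n)) : IsOpen (slitDomain φ) :=
  φ.open_target.prod isOpen_compl_singleton

lemma coords_mem_slitDomain (hφ : φ ∈ atlas (𝔼 n) M) {p : TangentBundle (𝓡 n) M}
    (hp : p.1 ∈ φ.source) (h : p.2 ≠ 0) : coords φ p ∈ slitDomain φ :=
  ⟨φ.map_source hp, coords_snd_ne_zero hφ hp h⟩

namespace IsFinslerMetric

variable {F : TangentBundle (𝓡 n) M → ℝ}

lemma contDiffOn_sqLoc (hF : IsFinslerMetric F) (hφ : φ ∈ atlas (𝔼 n) M) :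
    ContDiffOn ℝ ∞ (sqLoc F φ) (slitDomain φ) := by
  rw [← contMDiffOn_iff_contDiffOn]
  have h1 : ContMDiffOn 𝓘(ℝ, (𝔼 n) × (𝔼 n)) 𝓘(ℝ, ℝ) ∞ (fun q => F (ofCoords φ q))
      (slitDomain φ) :=
    hF.smoothOn.comp ((contMDiffOn_ofCoords hφ).mono (prod_mono_right (subset_univ _)))
      fun q hq => ofCoords_snd_ne_zero hφ hq.1 hq.2
  have h2 : ContDiff ℝ ∞ fun x : ℝ => x ^ 2 := by fun_prop
  exact h2.contMDiff.comp_contMDiffOn h1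

lemma contDiffAt_sqLoc (hF : IsFinslerMetric F) (hφ : φ ∈ atlas (𝔼 n) M) {q : (𝔼 n) × (𝔼 n)}
    (hq : q ∈ slitDomain φ) : ContDiffAt ℝ ∞ (sqLoc F φ) q :=
  (hF.contDiffOn_sqLoc hφ).contDiffAt ((isOpen_slitDomain φ).mem_nhds hq)

lemma posDef_fiberHessian (hF : IsFinslerMetric F) (hφ : φ ∈ atlas (𝔼 n) M)
    {q : (𝔼 n) × (𝔼 n)} (hq : q ∈ slitDomain φ) : (fiberHessian (sqLoc F φ) q).PosDef := by
  have := hF.posDef φ hφ (ofCoords φ q) (φ.map_target hq.1) (ofCoords_snd_ne_zero hφ hq.1 hq.2)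
  rwa [coords_ofCoords hφ hq.1] at this

lemma sqLoc_smul (hF : IsFinslerMetric F) (φ : OpenPartialHomeomorph M (𝔼 n))
    (q : (𝔼 n) × (𝔼 n)) (c : ℝ) (hc : 0 < c) :
    sqLoc F φ (q.1, c • q.2) = c ^ 2 * sqLoc F φ q := by
  have h : ofCoords φ (q.1, c • q.2) =
      ⟨φ.symm q.1, c • mfderiv (𝓡 n) (𝓡 n) φ.symm q.1 q.2⟩ := by
    exact totalSpace_mk_eq rfl _ _ ((mfderiv (𝓡 n) (𝓡 n) φ.symm q.1).map_smul c q.2)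
  rw [sqLoc, h, hF.homogeneous _ _ _ hc, mul_pow]
  rfl

lemma fderiv_fderiv_vertical (hF : IsFinslerMetric F) (hφ : φ ∈ atlas (𝔼 n) M)
    {q : (𝔼 n) × (𝔼 n)} (hq : q ∈ slitDomain φ) (w : 𝔼 n) :
    fderiv ℝ (fderiv ℝ (sqLoc F φ)) q (0, q.2) (0, w) = fderiv ℝ (sqLoc F φ) q (0, w) :=
  fderiv_fderiv_vertical_of_homogeneous (hF.contDiffAt_sqLoc hφ hq)
    (Eventually.of_forall fun p c hc => hF.sqLoc_smul φ p c hc) w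

lemma eulerLagrangeAt_of_transition (hF : IsFinslerMetric F) (hφ : φ ∈ atlas (𝔼 n) M)
    (hφ' : φ' ∈ atlas (𝔼 n) M) {q : (𝔼 n) × (𝔼 n)} (hq : q ∈ slitDomain φ')
    (hq' : φ'.symm q.1 ∈ φ.source) {a : 𝔼 n}
    (h : EulerLagrangeAt (sqLoc F φ) (tangentLift (φ ∘ φ'.symm) q)
      (fderiv ℝ (φ ∘ φ'.symm) q.1 a + fderiv ℝ (fderiv ℝ (φ ∘ φ'.symm)) q.1 q.2 q.2)) :
    EulerLagrangeAt (sqLoc F φ') q a := by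
  refine h.comp_tangentLift (contDiffAt_transition hφ hφ' hq.1 hq') ?_
    (hF.contDiffAt_sqLoc hφ' hq) (sqLoc_eventuallyEq F hφ hφ' hq.1 hq')
  have h1 := coords_eq_tangentLift hφ hφ' (p := ofCoords φ' q) hq' (φ'.map_target hq.1)
  rw [coords_ofCoords hφ' hq.1] at h1
  rw [← h1]
  exact hF.contDiffAt_sqLoc hφ
    (coords_mem_slitDomain hφ hq' (ofCoords_snd_ne_zero hφ' hq.1 hq.2))

/-- The fundamental tensor in an arbitrary chart. -/
lemma fundamentalTensor_eq (hF : IsFinslerMetric F) (hφ : φ ∈ atlas (𝔼 n) M)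
    {p : TangentBundle (𝓡 n) M} (hp : p.1 ∈ φ.source) (hp0 : p.2 ≠ 0)
    (v w : TangentSpace (𝓡 n) p.1) :
    fundamentalTensor F p v w = (1 / 2 : ℝ) * fderiv ℝ (fderiv ℝ (sqLoc F φ)) (coords φ p)
      (0, (coords φ ⟨p.1, v⟩).2) (0, (coords φ ⟨p.1, w⟩).2) := by
  set φ' := chartAt (𝔼 n) p.1 with hφ'
  have hA : φ' ∈ atlas (𝔼 n) M := chart_mem_atlas _ _
  have hp' : p.1 ∈ φ'.source := mem_chart_source _ _
  have hq := coords_mem_slitDomain hA hp' hp0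
  have hq' : φ'.symm (coords φ' p).1 ∈ φ.source := by
    change φ'.symm (φ' p.1) ∈ φ.source
    rwa [φ'.left_inv hp']
  have h1 : fundamentalTensor F p v w = _ :=
    sum_fiberHessian_mul_mul (hF.contDiffAt_sqLoc hA hq) (coords φ' ⟨p.1, v⟩).2
      (coords φ' ⟨p.1, w⟩).2
  have hT := coords_eq_tangentLift hφ hA hp hp'
  rw [h1, fderiv_fderiv_comp_tangentLift_vertical (contDiffAt_transition hφ hA hq.1 hq')
    (by rw [← hT]; exact hF.contDiffAt_sqLoc hφ (coords_mem_slitDomain hφ hp hp0))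
    (hF.contDiffAt_sqLoc hA hq) (sqLoc_eventuallyEq F hφ hA hq.1 hq'), ← hT]
  have hv : (coords φ ⟨p.1, v⟩).2 = _ :=
    congrArg Prod.snd (coords_eq_tangentLift hφ hA (p := ⟨p.1, v⟩) hp hp')
  have hw : (coords φ ⟨p.1, w⟩).2 = _ :=
    congrArg Prod.snd (coords_eq_tangentLift hφ hA (p := ⟨p.1, w⟩) hp hp')
  rw [hv, hw]
  rfl

lemma det_gMatrix_transition (hF : IsFinslerMetric F) (hφ : φ ∈ atlas (𝔼 n) M)
    (hφ' : φ' ∈ atlas (𝔼 n) M) {p : TangentBundle (𝓡 n) M} (hp : p.1 ∈ φ.source)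
    (hp' : p.1 ∈ φ'.source) (hp0 : p.2 ≠ 0) :
    (gMatrix F φ' (coords φ' p)).det = (fderiv ℝ (φ ∘ φ'.symm) (φ' p.1)).det ^ 2 *
      (gMatrix F φ (coords φ p)).det := by
  have hq := coords_mem_slitDomain hφ' hp' hp0
  have hq' : φ'.symm (coords φ' p).1 ∈ φ.source := by
    change φ'.symm (φ' p.1) ∈ φ.source
    rwa [φ'.left_inv hp']
  have hT := coords_eq_tangentLift hφ hφ' hp hp'
  rw [hT]
  exact det_fiberHessian_comp_tangentLift (contDiffAt_transition hφ hφ' hq.1 hq')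
    (by rw [← hT]; exact hF.contDiffAt_sqLoc hφ (coords_mem_slitDomain hφ hp hp0))
    (hF.contDiffAt_sqLoc hφ' hq) (sqLoc_eventuallyEq F hφ hφ' hq.1 hq')

end IsFinslerMetric

end Charts

section Distortion

set_option linter.unusedSectionVars false

local notation "𝔼" n => EuclideanSpace ℝ (Fin n)

/-! ### Densities -/

lemma le_of_forall_lintegral_ball_eq {A : Type*} [MetricSpace A] [MeasurableSpace A]
    [OpensMeasurableSpace A] [ProperSpace A] {μ : Measure A} [μ.IsOpenPosMeasure]
    [IsFiniteMeasureOnCompacts μ] {a b : A → ℝ} {O : Set A} (hO : IsOpen O)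
    (ha : ContinuousOn a O) (hb : ContinuousOn b O) (hb0 : ∀ u ∈ O, 0 < b u)
    (h : ∀ u r, 0 < r → Metric.ball u r ⊆ O →
      ∫⁻ x in Metric.ball u r, ENNReal.ofReal (a x) ∂μ =
        ∫⁻ x in Metric.ball u r, ENNReal.ofReal (b x) ∂μ) {u : A} (hu : u ∈ O) : a u ≤ b u := by
  by_contra! hlt
  obtain ⟨c₁, hc₁, hc₁a⟩ := exists_between hlt
  obtain ⟨c₂, hc₂, hc₂a⟩ := exists_between hc₁a
  have hc₁0 : 0 < c₁ := (hb0 u hu).trans hc₁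
  have ev : ∀ᶠ x in 𝓝 u, x ∈ O ∧ b x < c₁ ∧ c₂ < a x :=
    (show ∀ᶠ x in 𝓝 u, x ∈ O from hO.mem_nhds hu).and ((((hb.continuousAt (hO.mem_nhds hu)).eventually_lt_const hc₁)).and
      ((ha.continuousAt (hO.mem_nhds hu)).eventually_const_lt hc₂a))
  obtain ⟨r, hr, hball⟩ := Metric.eventually_nhds_iff_ball.1 ev
  have hle : ENNReal.ofReal c₂ * μ (Metric.ball u r) ≤ ENNReal.ofReal c₁ * μ (Metric.ball u r) := by
    calc ENNReal.ofReal c₂ * μ (Metric.ball u r)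
        = ∫⁻ _ in Metric.ball u r, ENNReal.ofReal c₂ ∂μ := (setLIntegral_const _ _).symm
      _ ≤ ∫⁻ x in Metric.ball u r, ENNReal.ofReal (a x) ∂μ :=
          setLIntegral_mono' measurableSet_ball fun x hx =>
            ENNReal.ofReal_le_ofReal (hball x hx).2.2.le
      _ = ∫⁻ x in Metric.ball u r, ENNReal.ofReal (b x) ∂μ := h u r hr fun x hx => (hball x hx).1
      _ ≤ ∫⁻ _ in Metric.ball u r, ENNReal.ofReal c₁ ∂μ :=
          setLIntegral_mono' measurableSet_ball fun x hx =>
            ENNReal.ofReal_le_ofReal (hball x hx).2.1.le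
      _ = ENNReal.ofReal c₁ * μ (Metric.ball u r) := setLIntegral_const _ _
  rw [ENNReal.mul_le_mul_iff_left (Metric.measure_ball_pos μ u hr).ne' measure_ball_lt_top.ne,
    ENNReal.ofReal_le_ofReal_iff hc₁0.le] at hle
  exact absurd hle (not_le.2 hc₂)

variable {n : ℕ} {M : Type*} [TopologicalSpace M] [ChartedSpace (𝔼 n) M]
  [IsManifold (𝓡 n) ∞ M] [MeasurableSpace M] [BorelSpace M] {m : Measure M}
  {φ φ' : OpenPartialHomeomorph M (𝔼 n)}

lemma IsSmoothMeasure.isDensity_density (hm : IsSmoothMeasure n m) (hφ : φ ∈ atlas (𝔼 n) M) :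
    IsDensity m φ (density m φ) :=
  Classical.epsilon_spec (hm φ hφ)

lemma IsSmoothMeasure.density_transition (hm : IsSmoothMeasure n m) (hφ : φ ∈ atlas (𝔼 n) M)
    (hφ' : φ' ∈ atlas (𝔼 n) M) {x : M} (hx : x ∈ φ.source) (hx' : x ∈ φ'.source) :
    density m φ' (φ' x) =
      |(fderiv ℝ (φ ∘ φ'.symm) (φ' x)).det| * density m φ (φ x) := by
  obtain ⟨hs, hpos, hint⟩ := hm.isDensity_density hφ
  obtain ⟨hs', hpos', hint'⟩ := hm.isDensity_density hφ'
  set T := φ ∘ φ'.symm with hT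
  set O := φ'.target ∩ φ'.symm ⁻¹' φ.source with hOdef
  have hO : IsOpen O := φ'.isOpen_inter_preimage_symm φ.open_source
  have hxO : φ' x ∈ O := ⟨φ'.map_source hx', by rwa [mem_preimage, φ'.left_inv hx']⟩
  have hTd : ∀ u ∈ O, ContDiffAt ℝ ∞ T u := fun u hu => contDiffAt_transition hφ hφ' hu.1 hu.2
  have hTO : ContDiffOn ℝ ∞ T O := fun u hu => (hTd u hu).contDiffWithinAt
  have hTmaps : ∀ u ∈ O, T u ∈ φ.target := fun u hu => φ.map_source hu.2
  have hinj : InjOn T O := fun u hu v hv huv =>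
    φ'.symm.injOn hu.1 hv.1 (φ.injOn hu.2 hv.2 huv)
  have hdet : ContinuousOn (fun u => (fderiv ℝ T u).det) O :=
    ContinuousLinearMap.continuous_det.comp_continuousOn
      (hTO.continuousOn_fderiv_of_isOpen hO (by simp))
  have hc : ContinuousOn (fun u => |(fderiv ℝ T u).det| * density m φ (T u)) O :=
    hdet.abs.mul (hs.continuousOn.comp hTO.continuousOn hTmaps)
  have hc' : ContinuousOn (density m φ') O := hs'.continuousOn.mono inter_subset_left
  have hdet0 : ∀ u ∈ O, (fderiv ℝ T u).det ≠ 0 := by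
    intro u hu
    set S := φ' ∘ φ.symm with hS
    have hTu : φ.symm (T u) = φ'.symm u := φ.left_inv hu.2
    have hSd : ContDiffAt ℝ ∞ S (T u) := contDiffAt_transition hφ' hφ (hTmaps u hu)
      (by rw [hTu]; exact φ'.map_target hu.1)
    have h1 := ((hSd.differentiableAt (by simp)).hasFDerivAt).comp u
      ((hTd u hu).differentiableAt (by simp)).hasFDerivAt
    have h2 : S ∘ T =ᶠ[𝓝 u] id := by
      filter_upwards [hO.mem_nhds hu] with v hv
      simp only [hS, hT, Function.comp_apply, id_eq, φ.left_inv hv.2, φ'.right_inv hv.1]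
    have h3 := h1.unique ((hasFDerivAt_id u).congr_of_eventuallyEq h2)
    have h4 : (fderiv ℝ S (T u)).det * (fderiv ℝ T u).det = 1 := by
      have := congrArg (fun A : (𝔼 n) →L[ℝ] 𝔼 n => LinearMap.det (A : (𝔼 n) →ₗ[ℝ] 𝔼 n)) h3
      simpa using this
    exact right_ne_zero_of_mul_eq_one h4
  have key : ∀ u r, 0 < r → Metric.ball u r ⊆ O →
      ∫⁻ x in Metric.ball u r, ENNReal.ofReal (density m φ' x) =
      ∫⁻ x in Metric.ball u r, ENNReal.ofReal (|(fderiv ℝ T x).det| * density m φ (T x)) := by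
    intro u r _ hB
    set B := Metric.ball u r with hBdef
    have hBt : B ⊆ φ'.target := fun v hv => (hB hv).1
    have hA : IsOpen (φ'.symm '' B) :=
      φ'.symm.isOpen_image_of_subset_source Metric.isOpen_ball hBt
    have hA' : φ' '' (φ'.symm '' B) = B := by
      rw [image_image]
      exact (image_congr fun v hv => φ'.right_inv (hBt hv)).trans (image_id' B)
    have hA'' : φ '' (φ'.symm '' B) = T '' B := by rw [image_image]; rfl
    have e1 := hint' _ hA.measurableSet (by
      rintro _ ⟨v, hv, rfl⟩
      exact φ'.map_target (hBt hv))
    have e2 := hint _ hA.measurableSet (by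
      rintro _ ⟨v, hv, rfl⟩
      exact (hB hv).2)
    rw [hA'] at e1
    rw [hA'', lintegral_image_eq_lintegral_abs_det_fderiv_mul volume measurableSet_ball
      (fun v hv => ((hTd v (hB hv)).differentiableAt
        (by simp)).hasFDerivAt.hasFDerivWithinAt) (hinj.mono hB)] at e2
    rw [← e1, e2]
    refine setLIntegral_congr_fun measurableSet_ball fun v _ => ?_
    exact (ENNReal.ofReal_mul (abs_nonneg _)).symm
  have hTx : T (φ' x) = φ x := by simp [hT, φ'.left_inv hx']
  rw [← hTx]
  refine le_antisymm
    (le_of_forall_lintegral_ball_eq (μ := volume) hO hc' hc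
      (fun u hu => mul_pos (abs_pos.2 (hdet0 u hu)) (hpos _ (hTmaps u hu))) key hxO)
    (le_of_forall_lintegral_ball_eq (μ := volume) hO hc hc' (fun u hu => hpos' u hu.1)
      (fun u r hr h => (key u r hr h).symm) hxO)

/-! ### The distortion in an arbitrary chart -/

variable {F : TangentBundle (𝓡 n) M → ℝ}

/-- The distortion as a function of the local coordinates of the chart `φ`. -/
noncomputable def localDistortion (F : TangentBundle (𝓡 n) M → ℝ) (m : Measure M)
    (φ : OpenPartialHomeomorph M (𝔼 n)) (q : (𝔼 n) × (𝔼 n)) : ℝ :=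
  Real.log (Real.sqrt (gMatrix F φ q).det / density m φ q.1)

lemma distortion_eq_localDistortion (hF : IsFinslerMetric F) (hm : IsSmoothMeasure n m)
    (hφ : φ ∈ atlas (𝔼 n) M) {p : TangentBundle (𝓡 n) M} (hp : p.1 ∈ φ.source) (hp0 : p.2 ≠ 0) :
    distortion F m p = localDistortion F m φ (coords φ p) := by
  set φ' := chartAt (𝔼 n) p.1 with hφ'
  have hA : φ' ∈ atlas (𝔼 n) M := chart_mem_atlas _ _
  have hp' : p.1 ∈ φ'.source := mem_chart_source _ _
  have h1 := hF.det_gMatrix_transition hφ hA hp hp' hp0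
  have h2 := hm.density_transition hφ hA hp hp'
  have h3 : 0 < density m φ' (φ' p.1) :=
    (hm.isDensity_density hA).2.1 _ (φ'.map_source hp')
  have h4 : |(fderiv ℝ (φ ∘ φ'.symm) (φ' p.1)).det| ≠ 0 := by
    intro h0
    rw [h2, h0, zero_mul] at h3
    exact lt_irrefl _ h3
  change Real.log (Real.sqrt (gMatrix F φ' (coords φ' p)).det / density m φ' (φ' p.1)) =
    Real.log (Real.sqrt (gMatrix F φ (coords φ p)).det / density m φ (φ p.1))
  rw [h1, h2, Real.sqrt_mul (sq_nonneg _), Real.sqrt_sq_eq_abs, mul_div_mul_left _ _ h4]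

lemma contDiffOn_localDistortion (hF : IsFinslerMetric F) (hm : IsSmoothMeasure n m)
    (hφ : φ ∈ atlas (𝔼 n) M) : ContDiffOn ℝ ∞ (localDistortion F m φ) (slitDomain φ) := by
  obtain ⟨hs, hpos, -⟩ := hm.isDensity_density hφ
  have hdet : ∀ q ∈ slitDomain φ, 0 < (gMatrix F φ q).det := fun q hq =>
    (hF.posDef_fiberHessian hφ hq).det_pos
  have h1 : ContDiffOn ℝ ∞ (fun q => (gMatrix F φ q).det) (slitDomain φ) :=
    contDiffOn_det (contDiffOn_fiberHessian (isOpen_slitDomain φ) (hF.contDiffOn_sqLoc hφ))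
  have h2 : ContDiffOn ℝ ∞ (fun q : (𝔼 n) × (𝔼 n) => density m φ q.1) (slitDomain φ) :=
    hs.comp contDiff_fst.contDiffOn fun q hq => hq.1
  refine ((h1.sqrt fun q hq => (hdet q hq).ne').div h2 fun q hq => (hpos _ hq.1).ne').log
    fun q hq => (div_pos (Real.sqrt_pos.2 (hdet q hq)) (hpos _ hq.1)).ne'

end Distortion

section Geodesics

set_option linter.unusedSectionVars false

local notation "𝔼" n => EuclideanSpace ℝ (Fin n)

variable {n : ℕ} {M : Type*} [TopologicalSpace M] [ChartedSpace (𝔼 n) M]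
  [IsManifold (𝓡 n) ∞ M] {φ φ' : OpenPartialHomeomorph M (𝔼 n)}
  {F : TangentBundle (𝓡 n) M → ℝ}

/-! ### Curves in charts -/

lemma hasDerivAt_chart_comp (hφ : φ ∈ atlas (𝔼 n) M) {γ : ℝ → M} {t : ℝ}
    (hγ : MDifferentiableAt 𝓘(ℝ, ℝ) (𝓡 n) γ t) (ht : γ t ∈ φ.source) :
    HasDerivAt (fun s => φ (γ s)) (coords φ (curveLift (n := n) γ t)).2 t := by
  have h1 := ((mdifferentiable_chart hφ).mdifferentiableAt ht).hasMFDerivAt.comp t hγ.hasMFDerivAt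
  have h2 : ∀ A : ℝ →L[ℝ] 𝔼 n, HasFDerivAt (fun s => φ (γ s)) A t →
      HasDerivAt (fun s => φ (γ s)) (A 1) t := fun A hA => hA.hasDerivAt
  exact h2 _ h1.hasFDerivAt

lemma coords_curveLift (hφ : φ ∈ atlas (𝔼 n) M) {γ : ℝ → M} {t : ℝ}
    (hγ : MDifferentiableAt 𝓘(ℝ, ℝ) (𝓡 n) γ t) (ht : γ t ∈ φ.source) :
    coords φ (curveLift (n := n) γ t) = (φ (γ t), deriv (fun s => φ (γ s)) t) :=
  Prod.ext rfl (hasDerivAt_chart_comp hφ hγ ht).deriv.symm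

lemma curveLift_eventuallyEq {γ η : ℝ → M} {t : ℝ} (h : γ =ᶠ[𝓝 t] η) :
    curveLift (n := n) γ =ᶠ[𝓝 t] curveLift η := by
  filter_upwards [h.eventuallyEq_nhds] with s hs
  refine totalSpace_mk_eq hs.self_of_nhds _ _ ?_
  exact congrArg (fun A : ℝ →L[ℝ] 𝔼 n => A 1) (hs.mfderiv_eq (I := 𝓘(ℝ, ℝ)) (I' := 𝓡 n))

lemma contDiffAt_chart_comp (hφ : φ ∈ atlas (𝔼 n) M) {γ : ℝ → M} {t : ℝ}
    (hγ : ContMDiffAt 𝓘(ℝ, ℝ) (𝓡 n) ∞ γ t) (ht : γ t ∈ φ.source) :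
    ContDiffAt ℝ ∞ (fun s => φ (γ s)) t := by
  rw [← contMDiffAt_iff_contDiffAt]
  exact (contMDiffAt_of_mem_maximalAtlas (IsManifold.subset_maximalAtlas hφ) ht).comp t hγ

/-- The acceleration `-2 Gⁱ` of the geodesics in the chart `φ`. -/
noncomputable def geodesicAcceleration (F : TangentBundle (𝓡 n) M → ℝ)
    (φ : OpenPartialHomeomorph M (𝔼 n)) (q : (𝔼 n) × (𝔼 n)) : 𝔼 n :=
  WithLp.toLp 2 fun i => -2 * spray F φ i q

lemma IsFinslerMetric.contDiffOn_geodesicAcceleration (hF : IsFinslerMetric F)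
    (hφ : φ ∈ atlas (𝔼 n) M) : ContDiffOn ℝ ∞ (geodesicAcceleration F φ) (slitDomain φ) := by
  rw [contDiffOn_euclidean]
  exact fun i => contDiffOn_const.mul (contDiffOn_localSpray (isOpen_slitDomain φ)
    (hF.contDiffOn_sqLoc hφ) (fun q hq => hF.posDef_fiberHessian hφ hq) i)

lemma IsFinslerMetric.eulerLagrangeAt_iff (hF : IsFinslerMetric F) (hφ : φ ∈ atlas (𝔼 n) M)
    {q : (𝔼 n) × (𝔼 n)} (hq : q ∈ slitDomain φ) {a : 𝔼 n} :
    EulerLagrangeAt (sqLoc F φ) q a ↔ a = geodesicAcceleration F φ q := by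
  rw [FinslerGeom.eulerLagrangeAt_iff (hF.contDiffAt_sqLoc hφ hq) (hF.posDef_fiberHessian hφ hq)]
  constructor
  · intro h
    ext i
    have h1 : a i + 2 * spray F φ i q = 0 := h i
    change a i = -2 * spray F φ i q
    linarith
  · rintro rfl i
    change -2 * spray F φ i q + 2 * spray F φ i q = 0
    ring

lemma IsGeodesicOn.mdifferentiableAt {γ : ℝ → M} {J : Set ℝ} (hγ : IsGeodesicOn F γ J)
    (hJ : IsOpen J) {t : ℝ} (ht : t ∈ J) : MDifferentiableAt 𝓘(ℝ, ℝ) (𝓡 n) γ t :=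
  (hγ.1.contMDiffAt (hJ.mem_nhds ht)).mdifferentiableAt (by simp)

lemma IsGeodesicOn.contDiffAt {γ : ℝ → M} {J : Set ℝ} (hγ : IsGeodesicOn F γ J)
    (hJ : IsOpen J) (hφ : φ ∈ atlas (𝔼 n) M) {t : ℝ} (ht : t ∈ J) (hs : γ t ∈ φ.source) :
    ContDiffAt ℝ ∞ (fun s => φ (γ s)) t :=
  contDiffAt_chart_comp hφ (hγ.1.contMDiffAt (hJ.mem_nhds ht)) hs

lemma IsGeodesicOn.hasDerivAt {γ : ℝ → M} {J : Set ℝ} (hγ : IsGeodesicOn F γ J)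
    (hJ : IsOpen J) (hφ : φ ∈ atlas (𝔼 n) M) {t : ℝ} (ht : t ∈ J) (hs : γ t ∈ φ.source) :
    HasDerivAt (fun s => (φ (γ s), deriv (fun r => φ (γ r)) s))
      (deriv (fun r => φ (γ r)) t,
        geodesicAcceleration F φ (φ (γ t), deriv (fun r => φ (γ r)) t)) t := by
  have hc := hγ.contDiffAt hJ hφ ht hs
  have h1 : HasDerivAt (fun s => φ (γ s)) _ t := (hc.differentiableAt (by simp)).hasDerivAt
  have h2 : HasDerivAt (deriv fun s => φ (γ s)) (deriv (deriv fun s => φ (γ s)) t) t :=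
    DifferentiableAt.hasDerivAt (((hc.fderiv_right (m := 1) (by norm_cast)).differentiableAt
      (by simp)).clm_apply (differentiableAt_const 1))
  have h3 : deriv (deriv fun s => φ (γ s)) t =
      geodesicAcceleration F φ (φ (γ t), deriv (fun r => φ (γ r)) t) := by
    ext i
    have := hγ.2 t ht φ hφ hs i
    change _ = -2 * spray F φ i _
    linarith
  rw [h3] at h2
  exact h1.prodMk h2

/-! ### Uniqueness of geodesics -/

theorem IsGeodesicThrough.eventuallyEq (hF : IsFinslerMetric F) {p : TangentBundle (𝓡 n) M}
    (hp : p.2 ≠ 0) {η₁ η₂ : ℝ → M} (h₁ : IsGeodesicThrough F p η₁)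
    (h₂ : IsGeodesicThrough F p η₂) : η₁ =ᶠ[𝓝 0] η₂ := by
  set φ := chartAt (𝔼 n) p.1 with hφdef
  have hφ : φ ∈ atlas (𝔼 n) M := chart_mem_atlas _ _
  have hps : p.1 ∈ φ.source := mem_chart_source _ _
  have hq := coords_mem_slitDomain hφ hps hp
  have hX : ContDiffAt ℝ 1 (fun q : (𝔼 n) × (𝔼 n) => (q.2, geodesicAcceleration F φ q))
      (coords φ p) :=
    (contDiffAt_snd.prodMk ((hF.contDiffOn_geodesicAcceleration hφ).contDiffAt
      ((isOpen_slitDomain φ).mem_nhds hq))).of_le (by norm_cast)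
  obtain ⟨K, W, hW, hlip⟩ := hX.exists_lipschitzOnWith
  have key : ∀ η, IsGeodesicThrough F p η → (∀ᶠ t in 𝓝 (0 : ℝ), η t ∈ φ.source ∧
      HasDerivAt (fun s => (φ (η s), deriv (fun r => φ (η r)) s))
      (deriv (fun r => φ (η r)) t,
        geodesicAcceleration F φ (φ (η t), deriv (fun r => φ (η r)) t)) t ∧
      (φ (η t), deriv (fun r => φ (η r)) t) ∈ W) ∧
      (φ (η 0), deriv (fun r => φ (η r)) 0) = coords φ p := by
    rintro η ⟨ε, hε, hη, hη0⟩
    have h0 : (0 : ℝ) ∈ Ioo (-ε) ε := ⟨by linarith, hε⟩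
    have hd := hη.mdifferentiableAt isOpen_Ioo h0
    have hη0' : η 0 = p.1 := congrArg Bundle.TotalSpace.proj hη0
    have hs0 : η 0 ∈ φ.source := by rwa [hη0']
    have hc : (φ (η 0), deriv (fun r => φ (η r)) 0) = coords φ p := by
      rw [← coords_curveLift hφ hd hs0, hη0]
    have hs : ∀ᶠ t in 𝓝 (0 : ℝ), η t ∈ φ.source :=
      hd.continuousAt.eventually (φ.open_source.mem_nhds hs0)
    have hder0 := hη.hasDerivAt isOpen_Ioo hφ h0 hs0
    have hWev := hder0.continuousAt.eventually (show ∀ᶠ q in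
      𝓝 (φ (η 0), deriv (fun r => φ (η r)) 0), q ∈ W by rw [hc]; exact hW)
    refine ⟨?_, hc⟩
    filter_upwards [hs, isOpen_Ioo.mem_nhds h0, hWev] with t ht ht' ht''
    exact ⟨ht, hη.hasDerivAt isOpen_Ioo hφ ht' ht, ht''⟩
  obtain ⟨k1, k1'⟩ := key η₁ h₁
  obtain ⟨k2, k2'⟩ := key η₂ h₂
  have := ODE_solution_unique_of_eventually (v := fun _ q => (q.2, geodesicAcceleration F φ q))
    (s := fun _ => W) (Eventually.of_forall fun _ => hlip) (k1.mono fun t ht => ht.2)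
    (k2.mono fun t ht => ht.2) (k1'.trans k2'.symm)
  filter_upwards [this, k1, k2] with t h e1 e2
  exact φ.injOn e1.1 e2.1 (congrArg Prod.fst h)

lemma IsGeodesicThrough.geodesicFrom_eventuallyEq (hF : IsFinslerMetric F)
    {p : TangentBundle (𝓡 n) M} (hp : p.2 ≠ 0) {η : ℝ → M} (h : IsGeodesicThrough F p η) :
    geodesicFrom F p =ᶠ[𝓝 0] η := by
  have h1 : IsGeodesicThrough F p (geodesicFrom F p) := Classical.epsilon_spec ⟨η, h⟩
  exact h1.eventuallyEq hF hp h

/-! ### Vector fields in charts -/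

lemma coords_field {V : (x : M) → TangentSpace (𝓡 n) x} {x : M} (hx : x ∈ φ.source) :
    coords φ ⟨x, V x⟩ = (φ x, fieldLoc φ V (φ x)) := by
  have h : ∀ x', x' = x → (coords φ ⟨x', V x'⟩).2 = (coords φ ⟨x, V x⟩).2 := by
    rintro _ rfl
    rfl
  exact Prod.ext rfl (h _ (φ.left_inv hx)).symm

lemma contDiffOn_fieldLoc (hφ : φ ∈ atlas (𝔼 n) M) {V : (x : M) → TangentSpace (𝓡 n) x}
    {S : Set M} {k : ℕ∞ω} (hk : k ≤ ∞) (hV : ContMDiffOn (𝓡 n) (𝓡 n).tangent k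
      (fun x => (⟨x, V x⟩ : TangentBundle (𝓡 n) M)) S) :
    ContDiffOn ℝ k (fieldLoc φ V) (φ.target ∩ φ.symm ⁻¹' S) := by
  rw [← contMDiffOn_iff_contDiffOn]
  have h1 : ContMDiffOn (𝓡 n) (𝓡 n) k φ.symm φ.target :=
    (contMDiffOn_symm_of_mem_maximalAtlas (IsManifold.subset_maximalAtlas hφ)).of_le hk
  have h2 := hV.comp (h1.mono inter_subset_left) fun u (hu : u ∈ φ.target ∩ φ.symm ⁻¹' S) => hu.2
  have h3 := ((contMDiffOn_coords hφ).of_le hk).comp h2 fun u hu => φ.map_target hu.1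
  exact contDiff_snd.contMDiff.comp_contMDiffOn h3

lemma IsGeodesicField.fieldLoc_ne_zero {U : Set M} {Y : (x : M) → TangentSpace (𝓡 n) x}
    (hY : IsGeodesicField F U Y) (hφ : φ ∈ atlas (𝔼 n) M) {u : 𝔼 n}
    (hu : u ∈ φ.target ∩ φ.symm ⁻¹' U) : fieldLoc φ Y u ≠ 0 :=
  coords_snd_ne_zero hφ (p := ⟨φ.symm u, Y (φ.symm u)⟩) (φ.map_target hu.1) (hY.ne_zero _ hu.2)

/-- Through every point of the domain of a geodesic field there is a geodesic tangent to it. -/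
lemma IsGeodesicField.exists_geodesic {U : Set M} {Y : (x : M) → TangentSpace (𝓡 n) x}
    (hY : IsGeodesicField F U Y) {x : M} (hx : x ∈ U) :
    ∃ (γ : ℝ → M) (ε : ℝ), 0 < ε ∧ γ 0 = x ∧ IsGeodesicOn F γ (Ioo (-ε) ε) ∧
      ∀ t ∈ Ioo (-ε) ε, γ t ∈ U ∧ curveLift (n := n) γ t = ⟨γ t, Y (γ t)⟩ := by
  have : IsManifold (𝓡 n) 1 M := IsManifold.of_le (n := ∞) (by norm_cast)
  have hYx : ContMDiffAt (𝓡 n) (𝓡 n).tangent 1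
      (fun x => (⟨x, Y x⟩ : TangentBundle (𝓡 n) M)) x :=
    (hY.smoothOn.contMDiffAt (hY.isOpen.mem_nhds hx)).of_le (by norm_cast)
  obtain ⟨γ, hγ0, hγ⟩ := exists_isMIntegralCurveAt_of_contMDiffAt_boundaryless 0 hYx
  have hU : ∀ᶠ t in 𝓝 (0 : ℝ), γ t ∈ U :=
    hγ.continuousAt.eventually (hY.isOpen.mem_nhds (by rwa [hγ0]))
  obtain ⟨ε, hε, hball⟩ := Metric.eventually_nhds_iff_ball.1 (hU.and hγ)
  rw [Real.ball_eq_Ioo, zero_sub, zero_add] at hball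
  refine ⟨γ, ε, hε, hγ0, hY.geodesic γ _ _ (fun t ht => (hball t ht).1)
    (fun t ht => (hball t ht).2.hasMFDerivWithinAt), fun t ht => ⟨(hball t ht).1, ?_⟩⟩
  refine totalSpace_mk_eq rfl _ _ ?_
  have h1 := congrArg (fun A : ℝ →L[ℝ] 𝔼 n => A 1) (hball t ht).2.mfderiv
  refine h1.trans ?_
  exact one_smul ℝ (Y (γ t) : 𝔼 n)

/-! ### The weight function and the S-curvature along a geodesic field -/

variable [MeasurableSpace M] [BorelSpace M] {m : Measure M} {U : Set M}
  {Y : (x : M) → TangentSpace (𝓡 n) x}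

/-- The weight function in the chart `φ`. -/
noncomputable def localWeight (F : TangentBundle (𝓡 n) M → ℝ) (m : Measure M)
    (φ : OpenPartialHomeomorph M (𝔼 n)) (Y : (x : M) → TangentSpace (𝓡 n) x) (u : 𝔼 n) : ℝ :=
  localDistortion F m φ (u, fieldLoc φ Y u)

lemma IsGeodesicField.isOpen_chart_domain (hY : IsGeodesicField F U Y) :
    IsOpen (φ.target ∩ φ.symm ⁻¹' U) := φ.isOpen_inter_preimage_symm hY.isOpen

lemma mem_chart_domain {x : M} (hx : x ∈ U) (hs : x ∈ φ.source) :
    φ x ∈ φ.target ∩ φ.symm ⁻¹' U :=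
  ⟨φ.map_source hs, by rwa [mem_preimage, φ.left_inv hs]⟩

lemma IsGeodesicField.weight_eq (hF : IsFinslerMetric F) (hm : IsSmoothMeasure n m)
    (hφ : φ ∈ atlas (𝔼 n) M) (hY : IsGeodesicField F U Y) {x : M} (hx : x ∈ U)
    (hs : x ∈ φ.source) : weight F m Y x = localWeight F m φ Y (φ x) := by
  rw [weight, distortion_eq_localDistortion hF hm hφ (p := ⟨x, Y x⟩) hs (hY.ne_zero x hx),
    coords_field hs]
  rfl

lemma IsGeodesicField.contDiffOn_localWeight (hF : IsFinslerMetric F) (hm : IsSmoothMeasure n m)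
    (hφ : φ ∈ atlas (𝔼 n) M) (hY : IsGeodesicField F U Y) :
    ContDiffOn ℝ ∞ (localWeight F m φ Y) (φ.target ∩ φ.symm ⁻¹' U) :=
  (contDiffOn_localDistortion hF hm hφ).comp
    (contDiffOn_id.prodMk (contDiffOn_fieldLoc hφ le_rfl hY.smoothOn))
    fun _ hu => ⟨hu.1, hY.fieldLoc_ne_zero hφ hu⟩

lemma IsGeodesicField.hasFDerivAt_localWeight (hF : IsFinslerMetric F) (hm : IsSmoothMeasure n m)
    (hφ : φ ∈ atlas (𝔼 n) M) (hY : IsGeodesicField F U Y) {x : M} (hx : x ∈ U)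
    (hs : x ∈ φ.source) :
    HasFDerivAt (localWeight F m φ Y) (fderiv ℝ (localWeight F m φ Y) (φ x)) (φ x) :=
  (((hY.contDiffOn_localWeight hF hm hφ).contDiffAt (hY.isOpen_chart_domain.mem_nhds
    (mem_chart_domain hx hs))).differentiableAt (by simp)).hasFDerivAt

lemma IsGeodesicField.mfderiv_weight (hF : IsFinslerMetric F) (hm : IsSmoothMeasure n m)
    (hφ : φ ∈ atlas (𝔼 n) M) (hY : IsGeodesicField F U Y) {x : M} (hx : x ∈ U)
    (hs : x ∈ φ.source) (w : TangentSpace (𝓡 n) x) :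
    mfderiv (𝓡 n) 𝓘(ℝ, ℝ) (weight F m Y) x w =
      fderiv ℝ (localWeight F m φ Y) (φ x) (coords φ ⟨x, w⟩).2 := by
  have h1 := (hY.hasFDerivAt_localWeight hF hm hφ hx hs).hasMFDerivAt.comp x
    ((mdifferentiable_chart hφ).mdifferentiableAt hs).hasMFDerivAt
  have h2 : weight F m Y =ᶠ[𝓝 x] localWeight F m φ Y ∘ φ := by
    filter_upwards [hY.isOpen.mem_nhds hx, φ.open_source.mem_nhds hs] with z hz hz'
    exact hY.weight_eq hF hm hφ hz hz'
  rw [(h1.congr_of_eventuallyEq h2).mfderiv]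
  rfl

lemma IsGeodesicField.sCurvature_eq (hF : IsFinslerMetric F) (hm : IsSmoothMeasure n m)
    (hφ : φ ∈ atlas (𝔼 n) M) (hY : IsGeodesicField F U Y) {x : M} (hx : x ∈ U)
    (hs : x ∈ φ.source) :
    sCurvature F m ⟨x, Y x⟩ = fderiv ℝ (localWeight F m φ Y) (φ x) (fieldLoc φ Y (φ x)) := by
  obtain ⟨γ, ε, hε, hγ0, hγ, hlift⟩ := hY.exists_geodesic hx
  have h0 : (0 : ℝ) ∈ Ioo (-ε) ε := ⟨by linarith, hε⟩
  have hthr : IsGeodesicThrough F ⟨x, Y x⟩ γ := ⟨ε, hε, hγ, by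
    rw [(hlift 0 h0).2, hγ0]⟩
  have hd := hγ.mdifferentiableAt isOpen_Ioo h0
  have hs0 : γ 0 ∈ φ.source := by rwa [hγ0]
  have hev : (fun t => distortion F m (curveLift (geodesicFrom F ⟨x, Y x⟩) t)) =ᶠ[𝓝 0]
      fun t => localWeight F m φ Y (φ (γ t)) := by
    filter_upwards [curveLift_eventuallyEq (n := n)
      (hthr.geodesicFrom_eventuallyEq hF (hY.ne_zero x hx)), isOpen_Ioo.mem_nhds h0,
      hd.continuousAt.eventually (φ.open_source.mem_nhds hs0)] with t h1 h2 h3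
    rw [h1, (hlift t h2).2]
    exact hY.weight_eq hF hm hφ (hlift t h2).1 h3
  have h1 := hasDerivAt_chart_comp hφ hd hs0
  rw [(hlift 0 h0).2, coords_field hs0, hγ0] at h1
  have h2 : HasFDerivAt (localWeight F m φ Y) (fderiv ℝ (localWeight F m φ Y) (φ x)) (φ (γ 0)) := by
    rw [hγ0]
    exact hY.hasFDerivAt_localWeight hF hm hφ hx hs
  rw [sCurvature, hev.deriv_eq]
  exact (h2.comp_hasDerivAt 0 h1).deriv

lemma IsGeodesicField.fderiv_localWeight_of_isGradientAt (hF : IsFinslerMetric F)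
    (hm : IsSmoothMeasure n m) (hφ : φ ∈ atlas (𝔼 n) M) (hY : IsGeodesicField F U Y) {x : M}
    (hx : x ∈ U) (hs : x ∈ φ.source) {V : (x : M) → TangentSpace (𝓡 n) x}
    (hV : IsGradientAt F Y (weight F m Y) x (V x)) :
    fderiv ℝ (localWeight F m φ Y) (φ x) (fieldLoc φ Y (φ x)) = (1 / 2 : ℝ) *
      fderiv ℝ (sqLoc F φ) (φ x, fieldLoc φ Y (φ x)) (0, fieldLoc φ V (φ x)) := by
  have h1 := hV (Y x)
  rw [hY.mfderiv_weight hF hm hφ hx hs, hF.fundamentalTensor_eq hφ (p := ⟨x, Y x⟩) hs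
    (hY.ne_zero x hx), coords_field hs, coords_field hs] at h1
  have hq : (φ x, fieldLoc φ Y (φ x)) ∈ slitDomain φ :=
    ⟨φ.map_source hs, hY.fieldLoc_ne_zero hφ (mem_chart_domain hx hs)⟩
  rw [← h1, isSymmSndFDerivAt_of_contDiffAt (hF.contDiffAt_sqLoc hφ hq)]
  exact congrArg _ (hF.fderiv_fderiv_vertical hφ hq _)

/-- The Lie derivative of `F²` along the complete lift of the gradient of the weight function is
twice the derivative of the S-curvature along the geodesic. -/
theorem IsGeodesicExtension.lieSq_eq (hF : IsFinslerMetric F) (hm : IsSmoothMeasure n m)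
    {p : TangentBundle (𝓡 n) M} (hY : IsGeodesicExtension F p U Y)
    {V : (x : M) → TangentSpace (𝓡 n) x}
    (hVd : ContMDiff (𝓡 n) (𝓡 n).tangent 2 (fun x => (⟨x, V x⟩ : TangentBundle (𝓡 n) M)))
    (hV : ∀ᶠ x in 𝓝 p.1, IsGradientAt F Y (weight F m Y) x (V x)) :
    lieSq F V p = 2 * sCurvatureDot F m p := by
  obtain ⟨hpU, hY, hYp⟩ := hY
  obtain ⟨x, y⟩ := p
  change Y x = y at hYp
  change x ∈ U at hpU
  subst hYp
  set φ := chartAt (𝔼 n) x with hφdef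
  have hφ : φ ∈ atlas (𝔼 n) M := chart_mem_atlas _ _
  have hs : x ∈ φ.source := mem_chart_source _ _
  obtain ⟨γ, ε, hε, hγ0, hγ, hlift⟩ := hY.exists_geodesic hpU
  have h0 : (0 : ℝ) ∈ Ioo (-ε) ε := ⟨by linarith, hε⟩
  have hthr : IsGeodesicThrough F ⟨x, Y x⟩ γ := ⟨ε, hε, hγ, by
    rw [(hlift 0 h0).2, hγ0]⟩
  have hd := hγ.mdifferentiableAt isOpen_Ioo h0
  have hs0 : γ 0 ∈ φ.source := by rwa [hγ0]
  have hz : ∀ t ∈ Ioo (-ε) ε, γ t ∈ φ.source →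
      (φ (γ t), deriv (fun r => φ (γ r)) t) = (φ (γ t), fieldLoc φ Y (φ (γ t))) := by
    intro t ht hts
    rw [← coords_curveLift hφ (hγ.mdifferentiableAt isOpen_Ioo ht) hts, (hlift t ht).2,
      coords_field hts]
  have hev : (fun t => sCurvature F m (curveLift (geodesicFrom F ⟨x, Y x⟩) t)) =ᶠ[𝓝 0]
      fun t => (1 / 2 : ℝ) * fderiv ℝ (sqLoc F φ) (φ (γ t), deriv (fun r => φ (γ r)) t)
        (0, fieldLoc φ V (φ (γ t))) := by
    have hgr : ∀ᶠ t in 𝓝 (0 : ℝ), IsGradientAt F Y (weight F m Y) (γ t) (V (γ t)) :=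
      hd.continuousAt.eventually (by rwa [hγ0])
    filter_upwards [curveLift_eventuallyEq (n := n)
      (hthr.geodesicFrom_eventuallyEq hF (hY.ne_zero x hpU)), isOpen_Ioo.mem_nhds h0,
      hd.continuousAt.eventually (φ.open_source.mem_nhds hs0), hgr] with t h1 h2 h3 h4
    rw [h1, (hlift t h2).2, hY.sCurvature_eq hF hm hφ (hlift t h2).1 h3,
      hY.fderiv_localWeight_of_isGradientAt hF hm hφ (hlift t h2).1 h3 h4, hz t h2 h3]
  have hq0 : (φ (γ 0), deriv (fun r => φ (γ r)) 0) = (φ x, fieldLoc φ Y (φ x)) := by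
    rw [hz 0 h0 hs0, hγ0]
  have hq : (φ (γ 0), deriv (fun r => φ (γ r)) 0) ∈ slitDomain φ := by
    rw [hq0]
    exact ⟨φ.map_source hs, hY.fieldLoc_ne_zero hφ (mem_chart_domain hpU hs)⟩
  have hEL := (hF.eulerLagrangeAt_iff hφ hq).2 rfl
  have hVloc : DifferentiableAt ℝ (fieldLoc φ V) (φ (γ 0)) := by
    have h1 := contDiffOn_fieldLoc hφ (by norm_cast) (contMDiffOn_univ.2 hVd)
    have h2 : φ.target ∩ φ.symm ⁻¹' univ = φ.target := by simp
    rw [h2] at h1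
    exact (h1.contDiffAt (φ.open_target.mem_nhds (φ.map_source hs0))).differentiableAt (by simp)
  have hcd : HasDerivAt (fun s => φ (γ s)) (deriv (fun r => φ (γ r)) 0) 0 :=
    ((hγ.contDiffAt isOpen_Ioo hφ h0 hs0).differentiableAt (by simp)).hasDerivAt
  have hder := hEL.hasDerivAt (z := fun s => (φ (γ s), deriv (fun r => φ (γ r)) s)) (t := 0)
    (hF.contDiffAt_sqLoc hφ hq) (hγ.hasDerivAt isOpen_Ioo hφ h0 hs0)
    (hVloc.hasFDerivAt.comp_hasDerivAt (0 : ℝ) hcd)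
  have hdot : sCurvatureDot F m ⟨x, Y x⟩ = _ :=
    hev.deriv_eq.trans (hder.const_mul (1 / 2 : ℝ)).deriv
  have hlie : lieSq F V ⟨x, Y x⟩ = fderiv ℝ (sqLoc F φ) (coords φ ⟨x, Y x⟩)
      (fieldLoc φ V (coords φ ⟨x, Y x⟩).1, fderiv ℝ (fieldLoc φ V) (coords φ ⟨x, Y x⟩).1
        (coords φ ⟨x, Y x⟩).2) := rfl
  have hdv : deriv (fun r => φ (γ r)) 0 = fieldLoc φ Y (φ x) := congrArg Prod.snd hq0
  rw [hlie, hdot, coords_field hs]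
  simp only [Function.comp_apply, hγ0, hdv]
  ring

end Geodesics

section Existence

set_option linter.unusedSectionVars false

local notation "𝔼" n => EuclideanSpace ℝ (Fin n)

/-! ### Regularity of integral curves -/

lemma contDiffAt_of_hasDerivAt_field {A : Type*} [NormedAddCommGroup A] [NormedSpace ℝ A]
    [CompleteSpace A] {y : A → A} {W : Set A} (hy : ContDiffOn ℝ ∞ y W) {c : ℝ → A} {a b : ℝ}
    (hc : ∀ t ∈ Ioo a b, HasDerivAt c (y (c t)) t) (hW : ∀ t ∈ Ioo a b, c t ∈ W) {t : ℝ}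
    (ht : t ∈ Ioo a b) : ContDiffAt ℝ ∞ c t := by
  obtain ⟨a', ha, hat⟩ := exists_between ht.1
  obtain ⟨b', htb, hb⟩ := exists_between ht.2
  have hsub : Icc a' b' ⊆ Ioo a b := Icc_subset_Ioo ha hb
  have h := ODE.contDiffOn_enat_Icc_of_hasDerivWithinAt (n := ⊤) (f := fun _ x => y x) (α := c)
    (tmin := a') (tmax := b') (u := W)
    (hy.comp contDiff_snd.contDiffOn fun q hq => hq.2)
    (fun s hs => (hc s (hsub hs)).hasDerivWithinAt) (fun s hs => hW s (hsub hs))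
  exact h.contDiffAt (Icc_mem_nhds hat htb)

lemma deriv_deriv_comp {A B : Type*} [NormedAddCommGroup A] [NormedSpace ℝ A]
    [NormedAddCommGroup B] [NormedSpace ℝ B] {T : A → B} {c : ℝ → A} {t : ℝ}
    (hT : ContDiffAt ℝ ∞ T (c t)) (hc : ContDiffAt ℝ ∞ c t) :
    deriv (deriv (T ∘ c)) t = fderiv ℝ T (c t) (deriv (deriv c) t) +
      fderiv ℝ (fderiv ℝ T) (c t) (deriv c t) (deriv c t) := by
  have h1 : deriv (T ∘ c) =ᶠ[𝓝 t] fun s => fderiv ℝ T (c s) (deriv c s) := by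
    have e1 := hc.continuousAt.eventually
      ((hT.of_le (m := 1) (by norm_cast)).eventually (by simp))
    have e2 := (hc.of_le (m := 1) (by norm_cast)).eventually (by simp)
    filter_upwards [e1, e2] with s h1 h2
    exact ((h1.differentiableAt (by simp)).hasFDerivAt.comp_hasDerivAt s
      (h2.differentiableAt (by simp)).hasDerivAt).deriv
  have hd : HasDerivAt c (deriv c t) t := (hc.differentiableAt (by simp)).hasDerivAt
  have hdd : HasDerivAt (deriv c) (deriv (deriv c) t) t :=
    DifferentiableAt.hasDerivAt (((hc.fderiv_right (m := 1) (by norm_cast)).differentiableAt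
      (by simp)).clm_apply (differentiableAt_const 1))
  have h2 := (((hasFDerivAt_fderiv_of_contDiffAt hT).comp_hasDerivAt t hd).clm_apply hdd).deriv
  exact h1.deriv_eq.trans (h2.trans (add_comm _ _))

variable {n : ℕ} {M : Type*} [TopologicalSpace M] [ChartedSpace (𝔼 n) M]
  [IsManifold (𝓡 n) ∞ M] {φ φ' : OpenPartialHomeomorph M (𝔼 n)}
  {F : TangentBundle (𝓡 n) M → ℝ}

/-! ### Vector fields with given local components -/

/-- The vector field whose local components in the chart `φ` are `y`. -/
noncomputable def fieldOfLoc (φ : OpenPartialHomeomorph M (𝔼 n)) (y : (𝔼 n) → 𝔼 n) (x : M) :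
    TangentSpace (𝓡 n) x :=
  (mfderiv (𝓡 n) (𝓡 n) φ.symm (φ x) (y (φ x)) : 𝔼 n)

lemma mk_fieldOfLoc (y : (𝔼 n) → 𝔼 n) {x : M} (hx : x ∈ φ.source) :
    (⟨x, fieldOfLoc φ y x⟩ : TangentBundle (𝓡 n) M) = ofCoords φ (φ x, y (φ x)) :=
  totalSpace_mk_eq (φ.left_inv hx).symm _ _ rfl

lemma coords_fieldOfLoc (hφ : φ ∈ atlas (𝔼 n) M) (y : (𝔼 n) → 𝔼 n) {x : M}
    (hx : x ∈ φ.source) : coords φ ⟨x, fieldOfLoc φ y x⟩ = (φ x, y (φ x)) := by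
  rw [mk_fieldOfLoc y hx, coords_ofCoords hφ (φ.map_source hx)]

lemma contMDiffOn_fieldOfLoc (hφ : φ ∈ atlas (𝔼 n) M) {y : (𝔼 n) → 𝔼 n} {W : Set (𝔼 n)}
    (hy : ContDiffOn ℝ ∞ y W) :
    ContMDiffOn (𝓡 n) (𝓡 n).tangent ∞
      (fun x => (⟨x, fieldOfLoc φ y x⟩ : TangentBundle (𝓡 n) M)) (φ.source ∩ φ ⁻¹' W) := by
  have h1 : ContMDiffOn (𝓡 n) (𝓡 n) ∞ φ φ.source :=
    contMDiffOn_of_mem_maximalAtlas (IsManifold.subset_maximalAtlas hφ)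
  have h2 : ContMDiffOn (𝓡 n) 𝓘(ℝ, (𝔼 n) × (𝔼 n)) ∞ (fun x => (φ x, y (φ x)))
      (φ.source ∩ φ ⁻¹' W) :=
    (contDiffOn_id.prodMk hy).contMDiffOn.comp (h1.mono inter_subset_left) fun x hx => hx.2
  refine ((contMDiffOn_ofCoords hφ).comp h2 fun x hx => ⟨φ.map_source hx.1, mem_univ _⟩).congr
    fun x hx => ?_
  exact mk_fieldOfLoc y hx.1

/-! ### Existence of geodesic extensions -/

theorem IsFinslerMetric.exists_isGeodesicExtension (hF : IsFinslerMetric F)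
    {p : TangentBundle (𝓡 n) M} (hp : p.2 ≠ 0) :
    ∃ (U : Set M) (Y : (x : M) → TangentSpace (𝓡 n) x), IsGeodesicExtension F p U Y := by
  set φ := chartAt (𝔼 n) p.1 with hφdef
  have hφ : φ ∈ atlas (𝔼 n) M := chart_mem_atlas _ _
  have hs : p.1 ∈ φ.source := mem_chart_source _ _
  have hq := coords_mem_slitDomain hφ hs hp
  obtain ⟨W, y, hW, hpW, hy, hyp, hyW⟩ := exists_local_field_of_second_order
    (isOpen_slitDomain φ) (hF.contDiffOn_geodesicAcceleration hφ)
    (u₀ := (coords φ p).1) (v₀ := (coords φ p).2) hq hq.2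
  refine ⟨φ.source ∩ φ ⁻¹' W, fieldOfLoc φ y, ⟨hs, hpW⟩,
    ⟨φ.isOpen_inter_preimage hW, contMDiffOn_fieldOfLoc hφ hy, ?_, ?_⟩, ?_⟩
  · intro x hx h0
    apply (hyW _ hx.2).1.2
    have h1 : (coords φ ⟨x, fieldOfLoc φ y x⟩).2 = y (φ x) :=
      congrArg Prod.snd (coords_fieldOfLoc hφ y hx.1)
    rw [mem_singleton_iff, ← h1, h0]
    exact map_zero (mfderiv (𝓡 n) (𝓡 n) φ x)
  · intro γ a b hU hγ
    have hmd : ∀ t ∈ Ioo a b, HasMFDerivAt 𝓘(ℝ, ℝ) (𝓡 n) γ t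
        ((1 : ℝ →L[ℝ] ℝ).smulRight (fieldOfLoc φ y (γ t))) := fun t ht =>
      (hγ t ht).hasMFDerivAt (isOpen_Ioo.mem_nhds ht)
    have hlift : ∀ t ∈ Ioo a b, curveLift (n := n) γ t = ⟨γ t, fieldOfLoc φ y (γ t)⟩ := by
      intro t ht
      refine totalSpace_mk_eq rfl _ _ ?_
      refine (congrArg (fun A : ℝ →L[ℝ] 𝔼 n => A 1) (hmd t ht).mfderiv).trans ?_
      exact one_smul ℝ (fieldOfLoc φ y (γ t) : 𝔼 n)
    have hc : ∀ t ∈ Ioo a b, HasDerivAt (fun s => φ (γ s)) (y (φ (γ t))) t := by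
      intro t ht
      have := hasDerivAt_chart_comp hφ (hmd t ht).mdifferentiableAt (hU t ht).1
      rwa [hlift t ht, coords_fieldOfLoc hφ y (hU t ht).1] at this
    have hcs : ∀ t ∈ Ioo a b, ContDiffAt ℝ ∞ (fun s => φ (γ s)) t := fun t ht =>
      contDiffAt_of_hasDerivAt_field hy hc (fun s hs => (hU s hs).2) ht
    have hγs : ∀ t ∈ Ioo a b, ContMDiffAt 𝓘(ℝ, ℝ) (𝓡 n) ∞ γ t := by
      intro t ht
      have h1 := (contMDiffAt_symm_of_mem_maximalAtlas (IsManifold.subset_maximalAtlas hφ)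
        (φ.map_source (hU t ht).1)).comp t (hcs t ht).contMDiffAt
      refine h1.congr_of_eventuallyEq ?_
      filter_upwards [isOpen_Ioo.mem_nhds ht] with s hs
      exact (φ.left_inv (hU s hs).1).symm
    refine ⟨fun t ht => (hγs t ht).contMDiffWithinAt, fun t ht φ' hφ' hs' i => ?_⟩
    have hcs' : ContDiffAt ℝ ∞ (fun s => φ' (γ s)) t := contDiffAt_chart_comp hφ' (hγs t ht) hs'
    have hmdt := (hmd t ht).mdifferentiableAt
    have hlift0 : (curveLift (n := n) γ t).2 ≠ 0 := by
      intro h0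
      apply (hyW _ (hU t ht).2).1.2
      rw [mem_singleton_iff, ← (hc t ht).deriv]
      have h1 := congrArg Prod.snd (coords_curveLift hφ hmdt (hU t ht).1)
      have h2 : (coords φ (curveLift (n := n) γ t)).2 = 0 := by
        change mfderiv (𝓡 n) (𝓡 n) φ (γ t) (curveLift (n := n) γ t).2 = 0
        rw [h0]
        exact map_zero (mfderiv (𝓡 n) (𝓡 n) φ (γ t))
      exact h1.symm.trans h2
    have hq' : (φ' (γ t), deriv (fun s => φ' (γ s)) t) ∈ slitDomain φ' := by
      rw [← coords_curveLift hφ' hmdt hs']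
      exact coords_mem_slitDomain hφ' hs' hlift0
    have hleft : φ'.symm (φ' (γ t)) = γ t := φ'.left_inv hs'
    have hT : ContDiffAt ℝ ∞ (φ ∘ φ'.symm) (φ' (γ t)) :=
      contDiffAt_transition hφ hφ' (φ'.map_source hs') (by rw [hleft]; exact (hU t ht).1)
    have hdd : deriv (deriv fun s => φ (γ s)) t =
        geodesicAcceleration F φ (φ (γ t), y (φ (γ t))) := by
      have h1 : (deriv fun s => φ (γ s)) =ᶠ[𝓝 t] fun s => y (φ (γ s)) := by
        filter_upwards [isOpen_Ioo.mem_nhds ht] with s hs using (hc s hs).deriv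
      have h2 : HasFDerivAt y (fderiv ℝ y (φ (γ t))) (φ (γ t)) :=
        ((hy.contDiffAt (hW.mem_nhds (hU t ht).2)).differentiableAt (by simp)).hasFDerivAt
      rw [h1.deriv_eq, ← (hyW _ (hU t ht).2).2]
      exact (h2.comp_hasDerivAt t (hc t ht)).deriv
    have hcomp : (fun s => φ (γ s)) =ᶠ[𝓝 t] (φ ∘ φ'.symm) ∘ fun s => φ' (γ s) := by
      filter_upwards [(hγs t ht).continuousAt.eventually (φ'.open_source.mem_nhds hs')] with s hs
      simp [φ'.left_inv hs]
    have hacc := deriv_deriv_comp (T := φ ∘ φ'.symm) (c := fun s => φ' (γ s)) hT hcs'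
    rw [← hcomp.deriv.deriv_eq, hdd] at hacc
    have hlq : tangentLift (φ ∘ φ'.symm) (φ' (γ t), deriv (fun s => φ' (γ s)) t) =
        (φ (γ t), y (φ (γ t))) := by
      rw [← coords_curveLift hφ' hmdt hs', ← coords_eq_tangentLift hφ hφ' (hU t ht).1 hs',
        hlift t ht, coords_fieldOfLoc hφ y (hU t ht).1]
    have hEL : EulerLagrangeAt (sqLoc F φ') (φ' (γ t), deriv (fun s => φ' (γ s)) t)
        (deriv (deriv fun s => φ' (γ s)) t) := by
      refine hF.eulerLagrangeAt_of_transition hφ hφ' hq' (by rw [hleft]; exact (hU t ht).1) ?_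
      rw [← hacc, hlq]
      exact (hF.eulerLagrangeAt_iff hφ (hyW _ (hU t ht).2).1).2 rfl
    have hfin := (hF.eulerLagrangeAt_iff hφ' hq').1 hEL
    rw [hfin]
    change -2 * spray F φ' i _ + 2 * spray F φ' i _ = 0
    ring
  · have h1 : (⟨p.1, fieldOfLoc φ y p.1⟩ : TangentBundle (𝓡 n) M) = p := by
      rw [mk_fieldOfLoc y hs]
      change ofCoords φ ((coords φ p).1, y (coords φ p).1) = p
      rw [hyp]
      exact ofCoords_coords hφ hs
    exact eq_of_heq (Bundle.TotalSpace.mk.inj h1).2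

/-! ### Existence of the gradient of the weight function -/

variable [T2Space M] [MeasurableSpace M] [BorelSpace M] {m : Measure M} {U : Set M}
  {Y : (x : M) → TangentSpace (𝓡 n) x}

theorem IsGeodesicField.exists_gradient (hF : IsFinslerMetric F) (hm : IsSmoothMeasure n m)
    (hY : IsGeodesicField F U Y) {x₀ : M} (hx₀ : x₀ ∈ U) :
    ∃ V : (x : M) → TangentSpace (𝓡 n) x,
      ContMDiff (𝓡 n) (𝓡 n).tangent ∞ (fun x => (⟨x, V x⟩ : TangentBundle (𝓡 n) M)) ∧
      ∀ᶠ x in 𝓝 x₀, IsGradientAt F Y (weight F m Y) x (V x) := by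
  set φ := chartAt (𝔼 n) x₀ with hφdef
  have hφ : φ ∈ atlas (𝔼 n) M := chart_mem_atlas _ _
  have hs : x₀ ∈ φ.source := mem_chart_source _ _
  set O := φ.target ∩ φ.symm ⁻¹' U with hOdef
  have hO : IsOpen O := hY.isOpen_chart_domain
  let g : (𝔼 n) → Matrix (Fin n) (Fin n) ℝ := fun u =>
    fiberHessian (sqLoc F φ) (u, fieldLoc φ Y u)
  let Ψ := localWeight F m φ Y
  have hmem : ∀ u ∈ O, (u, fieldLoc φ Y u) ∈ slitDomain φ := fun u hu =>
    ⟨hu.1, hY.fieldLoc_ne_zero hφ hu⟩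
  have hg : ∀ u ∈ O, (g u).PosDef := fun u hu => hF.posDef_fiberHessian hφ (hmem u hu)
  have hgs : ∀ i j, ContDiffOn ℝ ∞ (fun u => g u i j) O := fun i j =>
    (contDiffOn_fiberHessian (isOpen_slitDomain φ) (hF.contDiffOn_sqLoc hφ) i j).comp
      (contDiffOn_id.prodMk (contDiffOn_fieldLoc hφ le_rfl hY.smoothOn)) hmem
  have hΨ : ContDiffOn ℝ ∞ Ψ O := hY.contDiffOn_localWeight hF hm hφ
  let D : (𝔼 n) → Fin n → ℝ := fun u j => fderiv ℝ Ψ u (EuclideanSpace.single j 1)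
  let v : (𝔼 n) → 𝔼 n := fun u => WithLp.toLp 2 fun i => ∑ j, (g u)⁻¹ i j * D u j
  have hv : ContDiffOn ℝ ∞ v O := by
    rw [contDiffOn_euclidean]
    intro i
    change ContDiffOn ℝ ∞ (fun u => ∑ j, (g u)⁻¹ i j * D u j) O
    exact ContDiffOn.sum fun j _ =>
      (contDiffOn_inv_apply hgs (fun u hu => (hg u hu).det_pos.ne') i j).mul
        ((hΨ.fderiv_of_isOpen hO (by simp)).clm_apply contDiffOn_const)
  have hgv : ∀ u ∈ O, ∀ j, ∑ i, g u i j * v u i = D u j := by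
    intro u hu j
    have h1 : (g u).mulVec ((g u)⁻¹.mulVec (D u)) = D u := by
      rw [Matrix.mulVec_mulVec, Matrix.mul_nonsing_inv _
        (isUnit_iff_ne_zero.2 (hg u hu).det_pos.ne'), Matrix.one_mulVec]
    rw [← congrFun h1 j]
    refine Finset.sum_congr rfl fun i _ => ?_
    have h2 : g u i j = g u j i := by simpa using (hg u hu).isHermitian.apply j i
    rw [h2]
    rfl
  set S := φ.source ∩ φ ⁻¹' O with hSdef
  have hS : IsOpen S := φ.isOpen_inter_preimage hO
  have hx₀S : x₀ ∈ S := ⟨hs, mem_chart_domain hx₀ hs⟩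
  have hSU : ∀ x ∈ S, x ∈ U := fun x hx => by
    have := hx.2.2
    rwa [mem_preimage, φ.left_inv hx.1] at this
  have hgrad : ∀ x ∈ S, IsGradientAt F Y (weight F m Y) x (fieldOfLoc φ v x) := by
    intro x hx w
    have hq := hmem _ hx.2
    rw [hY.mfderiv_weight hF hm hφ (hSU x hx) hx.1, hF.fundamentalTensor_eq hφ (p := ⟨x, Y x⟩)
      hx.1 (hY.ne_zero x (hSU x hx)), coords_field hx.1, coords_fieldOfLoc hφ v hx.1,
      ← sum_fiberHessian_mul_mul (hF.contDiffAt_sqLoc hφ hq), Finset.sum_comm,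
      clm_apply_eq_sum (fderiv ℝ (localWeight F m φ Y) (φ x))]
    refine Finset.sum_congr rfl fun j _ => ?_
    rw [← Finset.sum_mul]
    have := hgv _ hx.2 j
    change (∑ i, g (φ x) i j * v (φ x) i) * _ = _ * D (φ x) j
    rw [this, mul_comm]
  obtain ⟨ρ, -, hρ⟩ := (SmoothBumpFunction.nhds_basis_tsupport (I := 𝓡 n) x₀).mem_iff.1
    (hS.mem_nhds hx₀S)
  refine ⟨fun x => ρ x • fieldOfLoc φ v x, ?_, ?_⟩
  · exact ContMDiffOn.smul_section_of_tsupport ρ.contMDiff.contMDiffOn hS hρ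
      (contMDiffOn_fieldOfLoc hφ hv)
  · filter_upwards [hS.mem_nhds hx₀S, ρ.eventuallyEq_one] with x hx h1
    have h2 : ρ x • fieldOfLoc φ v x = fieldOfLoc φ v x := by
      rw [h1]
      exact one_smul ℝ (fieldOfLoc φ v x : 𝔼 n)
    rw [h2]
    exact hgrad x hx

/-! ### Gradient almost Ricci solitons and the weighted Ricci curvature -/

theorem isGradientAlmostRicciSoliton_iff (hF : IsFinslerMetric F) (hm : IsSmoothMeasure n m)
    (κ : M → ℝ) : IsGradientAlmostRicciSoliton F m κ ↔ RicciInftyEq F m κ := by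
  constructor
  · intro h p hp
    obtain ⟨U, Y, hY, V, hVd, hV, heq⟩ := h p hp
    rw [hY.lieSq_eq hF hm hVd hV] at heq
    rw [ricciInfty]
    linarith
  · intro h p hp
    obtain ⟨U, Y, hY⟩ := hF.exists_isGeodesicExtension hp
    obtain ⟨V, hVd, hV⟩ := hY.2.1.exists_gradient hF hm hY.1
    have hVd2 := hVd.of_le (m := 2) (by norm_cast)
    refine ⟨U, Y, hY, V, hVd2, hV, ?_⟩
    have h1 := h p hp
    rw [ricciInfty] at h1
    rw [hY.lieSq_eq hF hm hVd2 hV]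
    linarith

end Existence

end FinslerGeom

theorem theorem1p1 {n : ℕ} {M : Type*} [TopologicalSpace M] [T2Space M]
    [ChartedSpace (EuclideanSpace ℝ (Fin n)) M] [IsManifold (𝓡 n) ∞ M]
    [MeasurableSpace M] [BorelSpace M]
    (F : TangentBundle (𝓡 n) M → ℝ) (hF : FinslerGeom.IsFinslerMetric F)
    (m : Measure M) (hm : FinslerGeom.IsSmoothMeasure n m) :
    (∀ κ : M → ℝ,
      FinslerGeom.IsGradientAlmostRicciSoliton F m κ ↔ FinslerGeom.RicciInftyEq F m κ) ∧
    (∀ c : ℝ,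
      FinslerGeom.IsGradientRicciSoliton F m c ↔ FinslerGeom.RicciInftyEq F m (fun _ => c)) :=
  ⟨fun κ => FinslerGeom.isGradientAlmostRicciSoliton_iff hF hm κ,
    fun c => FinslerGeom.isGradientAlmostRicciSoliton_iff hF hm fun _ => c⟩
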